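/- **Corollary (Bounded average dynamic regret of GTAdam).** Consider $N\ge 1$ agents and a weight matrix $W=(w_{ij})\in\mathbb{R}^{N\times N}$ that is doubly stochastic (nonnegative entries, unit row and column sums), whose weighted digraph (an edge for each $w_{ij}>0$) is strongly connected, and for which the spectral radius $\sigma_W$ of $W-\frac1N 1_N1_N^\top$ is smaller than $1$. Let $L,q,\epsilon,G>0$ and $\beta_1\in(0,1)$. Then there is $\bar\alpha>0$ such that for every step-size $\alpha\in(0,\bar\alpha)$ there are $\rho(\alpha)\in(0,1)$ and $t_0\in\mathbb{N}$ (where $\bar\alpha$ depends only on $N,W,L,q,\beta_1,\epsilon,G$, and $\rho(\alpha),t_0$ only on these and on $\alpha$) for which the following holds. Let $n\in\mathbb N$, $\beta_2\in(0,1)$, $\eta,\zeta>0$, and let $f_{i,t}:\mathbb{R}^n\to\mathbb{R}$ ($1\le i\le N$, $t\ge0$) be differentiable and $q$-strongly convex, with $L$-Lipschitz gradients. Put $f_t=\sum_{i=1}^N f_{i,t}$, let $x_{\star,t}$ be the minimizer of $f_t$, and suppose that $\|\nabla f_{i,t}(x)-\nabla f_{i,t-1}(x)\|\le\eta$ and $\|x_{\star,t}-x_{\star,t-1}\|\le\zeta$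 for all $i$, all $x\in\mathbb{R}^n$ and all $t\ge1$. From arbitrary $x_{i,0}\in\mathbb{R}^n$, with $s_{i,0}=\nabla f_{i,0}(x_{i,0})$ and $m_{i,0}=v_{i,0}=0$, let for $t\ge1$ (square root, division, product $\odot$ and $\min$ elementwise) $$m_{i,t}=\beta_1m_{i,t-1}+(1-\beta_1)s_{i,t-1},\qquad v_{i,t}=\min\{\beta_2v_{i,t-1}+(1-\beta_2)s_{i,t-1}\odot s_{i,t-1},\,G\},$$ $$x_{i,t}=\sum_{j=1}^N w_{ij}x_{j,t-1}-\alpha\frac{m_{i,t}}{\sqrt{v_{i,t}+\epsilon}},\qquad s_{i,t}=\sum_{j=1}^N w_{ij}s_{j,t-1}+\nabla f_{i,t}(x_{i,t})-\nabla f_{i,t-1}(x_{i,t-1}).$$ Write $\bar u_t=\frac1N\sum_i u_{i,t}$ for $u\in\{x,s,m\}$, $R_T=\sum_{t=1}^T\big(f_t(\bar x_t)-f_t(x_{\star,t})\big)$ and $Q=\frac{L^2\eta^2}{N}+N\eta^2+\zeta^2$. Then $$\limsup_{T\to\infty}\frac{R_T}{T}\le\frac L2\,\frac{Q}{(1-\rho(\alpha))^2}.$$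 Moreover, with the same $\rho(\alpha)$, for all $t\ge t_0$, $$f_t(\bar x_t)-f_t(x_{\star,t})\le\frac L2\left(\rho(\alpha)^{2t}\|y_0\|^2+2\rho(\alpha)^t\frac{\|y_0\|\sqrt Q}{1-\rho(\alpha)}+\frac{Q}{(1-\rho(\alpha))^2}\right),$$ where $\|y_0\|^2=\|\bar m_0\|^2+\|\bar s_0-\bar m_0\|^2+\sum_i\|m_{i,0}-\bar m_0\|^2+\sum_i\|s_{i,0}-\bar s_0\|^2+\sum_i\|x_{i,0}-\bar x_0\|^2+\|\bar x_0-x_{\star,0}\|^2$. -/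

import Mathlib

open Filter

noncomputable section

/-- The decision space `ℝⁿ` with its Euclidean norm. -/
abbrev Dec (n : ℕ) : Type := EuclideanSpace ℝ (Fin n)

/-- The average `(1/N) ∑ i, u i` of the local variables of the `N` agents. -/
def avg {N n : ℕ} (u : Fin N → Dec n) : Dec n := (1 / (N : ℝ)) • ∑ i, u i

/-- The Euclidean norm of the stacked vector `col (u 1, …, u N)` in `ℝ^(N n)`. -/
def stackNorm {N n : ℕ} (u : Fin N → Dec n) : ℝ := Real.sqrt (∑ i, ‖u i‖ ^ 2)

/-- The norm of the stacked disagreement `u - 𝟏 ū`. -/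
def disagreement {N n : ℕ} (u : Fin N → Dec n) : ℝ := stackNorm (fun i => u i - avg u)

/-- The network cost `f_t = ∑ i, f_{i,t}`. -/
def totalCost {N n : ℕ} (f : Fin N → ℕ → Dec n → ℝ) (t : ℕ) (x : Dec n) : ℝ := ∑ i, f i t x

/-- The weighted digraph with an edge for each positive entry of `W` is strongly connected, `W` is
doubly stochastic (entrywise nonnegative, with unit row and column sums), and the spectral radius
`σ_W` of `W - (1/N) 1 1ᵀ` is smaller than one. -/
structure NetworkStructure {N : ℕ} (W : Matrix (Fin N) (Fin N) ℝ) : Prop where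
  doubly_stochastic : W ∈ doublyStochastic ℝ (Fin N)
  strongly_connected : ∀ i j, Relation.ReflTransGen (fun a b => 0 < W a b) i j
  spectral_gap : spectralRadius ℂ
    (Matrix.of fun i j => ((W i j - 1 / (N : ℝ) : ℝ) : ℂ)) < 1

/-- Differentiable, with `L`-Lipschitz gradient. -/
def LipschitzGradient {n : ℕ} (L : ℝ) (h : Dec n → ℝ) : Prop :=
  Differentiable ℝ h ∧ ∀ x y, ‖gradient h x - gradient h y‖ ≤ L * ‖x - y‖

/-- The local variables of all the agents: solution estimates `x`, gradient trackers `s`, first and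
second momentum estimates `m` and `v`. -/
structure AgentState (N n : ℕ) where
  x : Fin N → Dec n
  s : Fin N → Dec n
  m : Fin N → Dec n
  v : Fin N → Dec n

/-- The tuning parameters: step-size `α`, momentum parameters `β₁`, `β₂`, regularization `ε`,
saturation level `G`. -/
structure Tuning where
  α : ℝ
  β₁ : ℝ
  β₂ : ℝ
  ε : ℝ
  G : ℝ

/-- `m_{i,t} = β₁ m_{i,t-1} + (1 - β₁) s_{i,t-1}`. -/
def nextM {N n : ℕ} (p : Tuning) (z : AgentState N n) (i : Fin N) : Dec n :=
  p.β₁ • z.m i + (1 - p.β₁) • z.s i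

/-- `v_{i,t} = min {β₂ v_{i,t-1} + (1 - β₂) s_{i,t-1} ⊙ s_{i,t-1}, G}`, elementwise. -/
def nextV {N n : ℕ} (p : Tuning) (z : AgentState N n) (i : Fin N) : Dec n :=
  WithLp.toLp 2 fun k => min (p.β₂ * z.v i k + (1 - p.β₂) * (z.s i k * z.s i k)) p.G

/-- The update direction `d_{i,t} = m_{i,t} / √(v_{i,t} + ε)`, elementwise. -/
def nextD {N n : ℕ} (p : Tuning) (z : AgentState N n) (i : Fin N) : Dec n :=
  WithLp.toLp 2 fun k => nextM p z i k / Real.sqrt (nextV p z i k + p.ε)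

/-- `x_{i,t} = ∑ j, w_{ij} x_{j,t-1} - α d_{i,t}`. -/
def nextX {N n : ℕ} (W : Matrix (Fin N) (Fin N) ℝ) (p : Tuning) (z : AgentState N n)
    (i : Fin N) : Dec n :=
  ∑ j, W i j • z.x j - p.α • nextD p z i

/-- One iteration of GTAdam, from time `t` to time `t + 1`; the new tracker is
`s_{i,t+1} = ∑ j, w_{ij} s_{j,t} + ∇f_{i,t+1}(x_{i,t+1}) - ∇f_{i,t}(x_{i,t})`. -/
def gtadamStep {N n : ℕ} (W : Matrix (Fin N) (Fin N) ℝ) (p : Tuning)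
    (f : Fin N → ℕ → Dec n → ℝ) (t : ℕ) (z : AgentState N n) : AgentState N n where
  x := nextX W p z
  s := fun i => ∑ j, W i j • z.s j +
    (gradient (f i (t + 1)) (nextX W p z i) - gradient (f i t) (z.x i))
  m := nextM p z
  v := nextV p z

/-- The GTAdam trajectory from the initial estimates `x₀`, with `s_{i,0} = ∇f_{i,0}(x_{i,0})` and
`m_{i,0} = v_{i,0} = 0`. -/
def gtadam {N n : ℕ} (W : Matrix (Fin N) (Fin N) ℝ) (p : Tuning)
    (f : Fin N → ℕ → Dec n → ℝ) (x₀ : Fin N → Dec n) : ℕ → AgentState N n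
  | 0 =>
    { x := x₀
      s := fun i => gradient (f i 0) (x₀ i)
      m := fun _ => 0
      v := fun _ => 0 }
  | t + 1 => gtadamStep W p f t (gtadam W p f x₀ t)

/-- The vector `y = (‖m̄‖, ‖s̄ - m̄‖, ‖m - 𝟏 m̄‖, ‖s - 𝟏 s̄‖, ‖x - 𝟏 x̄‖, ‖x̄ - x⋆‖)`. -/
def errorVec {N n : ℕ} (z : AgentState N n) (xstar : Dec n) : EuclideanSpace ℝ (Fin 6) :=
  !₂[‖avg z.m‖, ‖avg z.s - avg z.m‖, disagreement z.m, disagreement z.s, disagreement z.x,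
    ‖avg z.x - xstar‖]

/-- The dynamic regret `R_T = ∑_{t=1}^T f_t(x̄_t) - ∑_{t=1}^T f_t(x⋆_t)` of a sequence of states. -/
def regret {N n : ℕ} (f : Fin N → ℕ → Dec n → ℝ) (z : ℕ → AgentState N n) (xstar : ℕ → Dec n)
    (T : ℕ) : ℝ :=
  ∑ t ∈ Finset.Icc 1 T, totalCost f t (avg (z t).x) - ∑ t ∈ Finset.Icc 1 T, totalCost f t (xstar t)

/-- The assumptions on the online problem: `L`-Lipschitz gradients, `q`-strong convexity, `xstar t`
minimizes `f_t`, and the variations of gradients and minimizers are bounded by `η` and `ζ`. -/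
structure OnlineProblem {N n : ℕ} (L q η ζ : ℝ) (f : Fin N → ℕ → Dec n → ℝ)
    (xstar : ℕ → Dec n) : Prop where
  lipschitz_gradient : ∀ i t, LipschitzGradient L (f i t)
  strong_convexity : ∀ i t, StrongConvexOn Set.univ q (f i t)
  minimizer : ∀ t x, totalCost f t (xstar t) ≤ totalCost f t x
  gradient_variation : ∀ i t x, ‖gradient (f i (t + 1)) x - gradient (f i t) x‖ ≤ η
  minimizer_variation : ∀ t, ‖xstar (t + 1) - xstar t‖ ≤ ζ

/-- `Q = L² η² / N + N η² + ζ²`. -/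
def Qconst (N : ℕ) (L η ζ : ℝ) : ℝ := L ^ 2 * η ^ 2 / N + N * η ^ 2 + ζ ^ 2

end

/-! The heart of the matter is an input-to-state bound `K * (l ^ t * ‖y₀‖ ^ 2 + Q)` on the
optimality gap at the average iterate, with `l < 1` and `K` depending only on the network, the
tuning other than `β₂`, `L` and `q` (`exists_gap_gtadam_le`). The rate `ρ` is then still free: taken
close enough to `1`, it makes `1 / (1 - ρ) ^ 2` swallow `K`, and `l < ρ ^ 2` lets `ρ ^ (2 * t)`
swallow `K * l ^ t` from some time on.

The bound comes from a scalar Lyapunov function with four ingredients: the square root of the gap,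
the distance of the momenta from the mean gradient at the average iterate, and the disagreements of
the trackers and of the iterates. Saturation at `G` keeps the diagonal preconditioner between `1 /
√(G + ε)` and `1 / √ε`, so the averaged direction is a descent direction up to the momentum error;
with smoothness and the Polyak–Łojasiewicz inequality the gap contracts at a rate proportional to
`α`. Column-stochasticity makes the average tracker equal the average of the local gradients.
Disagreements contract in a norm adapted to `W - (1/N) 1 1ᵀ`, whose existence is Gelfand's formula
(`exists_contractive_norm`).

For `α = 0` the three consensus and momentum errors form a triangular contractive system. For small
`α` a small-gain argument (`exists_coupled_contraction`) closes the loop with the gap, the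
variations `η` and `ζ` entering as an additive input. -/

/-! ### Quadratic bounds from smoothness and strong convexity -/

/-- Along the segment, `h` minus its linear part and minus the quadratic `M / 2 * ‖v‖ ^ 2 * t ^ 2`
has nonpositive derivative. -/
theorem le_quadratic_of_lipschitz_gradient {n : ℕ} {h : Dec n → ℝ} {M : ℝ}
    (hh : LipschitzGradient M h) (x y : Dec n) :
    h y ≤ h x + inner ℝ (gradient h x) (y - x) + M / 2 * ‖y - x‖ ^ 2 := by
  obtain ⟨hd, hM⟩ := hh
  set v := y - x with hv
  have hder : ∀ t : ℝ, HasDerivAt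
      (fun t : ℝ => h (x + t • v) - t * inner ℝ (gradient h x) v - M / 2 * ‖v‖ ^ 2 * t ^ 2)
      (inner ℝ (gradient h (x + t • v)) v - inner ℝ (gradient h x) v - M * ‖v‖ ^ 2 * t) t := by
    intro t
    have h1 : HasDerivAt (fun t : ℝ => x + t • v) v t := by
      simpa using ((hasDerivAt_id t).smul_const v).const_add x
    have h2 := (hd (x + t • v)).hasGradientAt.hasFDerivAt.comp_hasDerivAt t h1
    have h3 := (hasDerivAt_id t).mul_const (inner ℝ (gradient h x) v)
    have h4 := (hasDerivAt_pow 2 t).const_mul (M / 2 * ‖v‖ ^ 2)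
    refine ((h2.sub h3).sub h4).congr_deriv ?_
    simp
    ring
  have hanti : AntitoneOn
      (fun t : ℝ => h (x + t • v) - t * inner ℝ (gradient h x) v - M / 2 * ‖v‖ ^ 2 * t ^ 2)
      (Set.Icc 0 1) := by
    refine antitoneOn_of_deriv_nonpos (convex_Icc 0 1)
      (fun t _ => (hder t).continuousAt.continuousWithinAt)
      (fun t _ => (hder t).differentiableAt.differentiableWithinAt) fun t ht => ?_
    rw [interior_Icc] at ht
    rw [(hder t).deriv, ← inner_sub_left]
    have h1 := real_inner_le_norm (gradient h (x + t • v) - gradient h x) v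
    have h2 := hM (x + t • v) x
    rw [add_sub_cancel_left, norm_smul, Real.norm_of_nonneg ht.1.le] at h2
    nlinarith [mul_le_mul_of_nonneg_right h2 (norm_nonneg v)]
  have := hanti (Set.left_mem_Icc.2 zero_le_one) (Set.right_mem_Icc.2 zero_le_one) zero_le_one
  simp only [one_smul, zero_smul, add_zero] at this
  rw [hv, add_sub_cancel, ← hv] at this
  linarith

/-- Subtracting `q / 2 * ‖·‖ ^ 2` leaves a convex function, whose slope over the segment is at least
its derivative at the starting point. -/
theorem StrongConvexOn.quadratic_le {n : ℕ} {h : Dec n → ℝ} {q : ℝ}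
    (hq : StrongConvexOn Set.univ q h) (hd : Differentiable ℝ h) (x y : Dec n) :
    h x + inner ℝ (gradient h x) (y - x) + q / 2 * ‖y - x‖ ^ 2 ≤ h y := by
  set v := y - x with hv
  have hy : y = x + v := by rw [hv, add_sub_cancel]
  have hc := (strongConvexOn_iff_convex.1 hq).comp_affineMap (AffineMap.lineMap x y)
  have hl : ∀ t : ℝ, AffineMap.lineMap x y t = x + t • v := fun t => by
    rw [AffineMap.lineMap_apply, vsub_eq_sub, vadd_eq_add, add_comm]
  have hfun : ((fun z => h z - q / 2 * ‖z‖ ^ 2) ∘ (AffineMap.lineMap x y : ℝ →ᵃ[ℝ] Dec n)) =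
      fun t : ℝ => h (x + t • v) - q / 2 * (‖x‖ ^ 2 + 2 * t * inner ℝ x v + t ^ 2 * ‖v‖ ^ 2) := by
    funext t
    simp only [Function.comp_apply, hl]
    rw [norm_add_sq_real, inner_smul_right, norm_smul, mul_pow, Real.norm_eq_abs, sq_abs]
    ring
  rw [hfun, Set.preimage_univ] at hc
  have hder : HasDerivAt
      (fun t : ℝ => h (x + t • v) - q / 2 * (‖x‖ ^ 2 + 2 * t * inner ℝ x v + t ^ 2 * ‖v‖ ^ 2))
      (inner ℝ (gradient h x) v - q * inner ℝ x v) 0 := by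
    have h1 : HasDerivAt (fun t : ℝ => x + t • v) v 0 := by
      simpa using ((hasDerivAt_id (0 : ℝ)).smul_const v).const_add x
    have h2 := (hd (x + (0 : ℝ) • v)).hasGradientAt.hasFDerivAt.comp_hasDerivAt 0 h1
    have h3 := ((((hasDerivAt_id (0 : ℝ)).const_mul 2).mul_const (inner ℝ x v)).const_add
      (‖x‖ ^ 2)).add ((hasDerivAt_pow 2 (0 : ℝ)).mul_const (‖v‖ ^ 2))
    refine (h2.sub (h3.const_mul (q / 2))).congr_deriv ?_
    simp
    ring
  have := hc.le_slope_of_hasDerivAt (Set.mem_univ 0) (Set.mem_univ 1) zero_lt_one hder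
  simp only [slope_def_field, one_smul, zero_smul, add_zero] at this
  rw [← hy] at this
  nlinarith

/-! ### A norm adapted to the mixing matrix -/

/-- The action of a matrix on stacked vectors, `(B ⊗ I) u`. -/
def stackMul {N n : ℕ} (B : Matrix (Fin N) (Fin N) ℝ) (u : Fin N → Dec n) : Fin N → Dec n :=
  fun i => ∑ j, B i j • u j

theorem stackMul_add {N n : ℕ} (B : Matrix (Fin N) (Fin N) ℝ) (u v : Fin N → Dec n) :
    stackMul B (u + v) = stackMul B u + stackMul B v := by
  funext i
  simp [stackMul, Finset.sum_add_distrib]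

theorem stackMul_one {N n : ℕ} (u : Fin N → Dec n) : stackMul 1 u = u := by
  funext i
  simp [stackMul, Matrix.one_apply, ite_smul]

theorem stackMul_mul {N n : ℕ} (A B : Matrix (Fin N) (Fin N) ℝ) (u : Fin N → Dec n) :
    stackMul (A * B) u = stackMul A (stackMul B u) := by
  funext i
  simp only [stackMul, Matrix.mul_apply, Finset.sum_smul, Finset.smul_sum, smul_smul]
  rw [Finset.sum_comm]

theorem norm_stackMul_le {N n : ℕ} {B : Matrix (Fin N) (Fin N) ℝ} {c : ℝ} (hc : 0 ≤ c)
    (hB : ∀ i, ∑ j, |B i j| ≤ c) (u : Fin N → Dec n) : ‖stackMul B u‖ ≤ c * ‖u‖ := by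
  refine (pi_norm_le_iff_of_nonneg (by positivity)).2 fun i => ?_
  calc ‖∑ j, B i j • u j‖ ≤ ∑ j, |B i j| * ‖u‖ := by
        refine (norm_sum_le _ _).trans (Finset.sum_le_sum fun j _ => ?_)
        rw [norm_smul, Real.norm_eq_abs]
        exact mul_le_mul_of_nonneg_left (norm_le_pi_norm u j) (abs_nonneg _)
    _ ≤ c * ‖u‖ := by
        rw [← Finset.sum_mul]
        exact mul_le_mul_of_nonneg_right (hB i) (norm_nonneg u)

attribute [local instance] Matrix.linftyOpNormedRing Matrix.linftyOpNormedAlgebra in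
-- Gelfand's formula, applied to the operator norm given by the largest absolute row sum, for any
-- `γ` strictly between the spectral radius and `1`.
theorem exists_pow_sum_abs_le {N : ℕ} {B : Matrix (Fin N) (Fin N) ℝ}
    (hB : spectralRadius ℂ (B.map (algebraMap ℝ ℂ)) < 1) :
    ∃ γ : ℝ, 0 < γ ∧ γ < 1 ∧ ∃ K : ℕ, 0 < K ∧ ∀ i, ∑ j, |(B ^ K) i j| ≤ γ ^ K := by
  obtain ⟨γ, h1, h2⟩ := ENNReal.lt_iff_exists_nnreal_btwn.1 hB
  have hγ : 0 < γ := by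
    rw [← ENNReal.coe_pos]; exact bot_le.trans_lt h1
  have ht := spectrum.pow_nnnorm_pow_one_div_tendsto_nhds_spectralRadius (B.map (algebraMap ℝ ℂ))
  obtain ⟨K, hK, hKpos⟩ := ((ht.eventually (gt_mem_nhds h1)).and (eventually_gt_atTop 0)).exists
  refine ⟨γ, hγ, by exact_mod_cast h2, K, hKpos, fun i => ?_⟩
  have h3 : (‖(B.map (algebraMap ℝ ℂ)) ^ K‖₊ : ENNReal) ≤ (γ : ENNReal) ^ K := by
    have := ENNReal.rpow_le_rpow hK.le (Nat.cast_nonneg K : (0 : ℝ) ≤ K)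
    rwa [← ENNReal.rpow_mul, one_div_mul_cancel (by positivity), ENNReal.rpow_one,
      ENNReal.rpow_natCast] at this
  have h4 : ‖(B.map (algebraMap ℝ ℂ)) ^ K‖ ≤ (γ : ℝ) ^ K := by
    exact_mod_cast h3
  refine le_trans ?_ h4
  rw [← Matrix.map_pow, Matrix.linfty_opNorm_def]
  have h5 : ∑ j, |(B ^ K) i j| = ((∑ j, ‖((B ^ K).map (algebraMap ℝ ℂ)) i j‖₊ : NNReal) : ℝ) := by
    simp
  rw [h5]
  exact_mod_cast Finset.le_sup (f := fun i => ∑ j, ‖((B ^ K).map (algebraMap ℝ ℂ)) i j‖₊)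
    (Finset.mem_univ i)

/-- The norm is `∑ k < K, γ⁻¹ ^ k * ‖B ^ k u‖`. Applying `B` shifts the sum and pulls out a factor
`γ`; the new last term is at most the lost term `‖u‖` because `B ^ K` has row sums at most `γ ^ K`.
Both `γ` and `C` come from the matrix alone, hence are uniform in the dimension `n`. -/
theorem exists_contractive_norm {N : ℕ} {B : Matrix (Fin N) (Fin N) ℝ}
    (hB : spectralRadius ℂ (B.map (algebraMap ℝ ℂ)) < 1) :
    ∃ γ C : ℝ, 0 < γ ∧ γ < 1 ∧ 1 ≤ C ∧ ∀ n : ℕ, ∃ P : (Fin N → Dec n) → ℝ,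
      (∀ u v, P (u + v) ≤ P u + P v) ∧ (∀ u, ‖u‖ ≤ P u) ∧ (∀ u, P u ≤ C * ‖u‖) ∧
      ∀ u, P (stackMul B u) ≤ γ * P u := by
  obtain ⟨γ, h0, h1, K, hK, hsum⟩ := exists_pow_sum_abs_le hB
  set S : ℕ → ℝ := fun k => ∑ i, ∑ j, |(B ^ k) i j| with hS
  have hS0 : ∀ k, 0 ≤ S k := fun k => by positivity
  have hSle : ∀ k i, ∑ j, |(B ^ k) i j| ≤ S k := fun k i =>
    Finset.single_le_sum (f := fun i => ∑ j, |(B ^ k) i j|) (fun _ _ => by positivity)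
      (Finset.mem_univ i)
  refine ⟨γ, 1 + ∑ k ∈ Finset.range K, (γ⁻¹) ^ k * S k, h0, h1, ?_, fun n =>
    ⟨fun u => ∑ k ∈ Finset.range K, (γ⁻¹) ^ k * ‖stackMul (B ^ k) u‖, ?_, ?_, ?_, ?_⟩⟩
  · have : 0 ≤ ∑ k ∈ Finset.range K, (γ⁻¹) ^ k * S k :=
      Finset.sum_nonneg fun k _ => mul_nonneg (by positivity) (hS0 k)
    linarith
  · intro u v
    rw [← Finset.sum_add_distrib]
    refine Finset.sum_le_sum fun k _ => ?_
    rw [← mul_add, stackMul_add]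
    exact mul_le_mul_of_nonneg_left (norm_add_le _ _) (by positivity)
  · intro u
    have := Finset.single_le_sum (f := fun k => (γ⁻¹) ^ k * ‖stackMul (B ^ k) u‖)
      (fun _ _ => by positivity) (Finset.mem_range.2 hK)
    simpa [stackMul_one] using this
  · intro u
    rw [add_mul, one_mul, Finset.sum_mul]
    refine (Finset.sum_le_sum fun k _ => ?_).trans (le_add_of_nonneg_left (norm_nonneg u))
    rw [mul_assoc]
    exact mul_le_mul_of_nonneg_left (norm_stackMul_le (hS0 k) (hSle k) u) (by positivity)
  · intro u
    have hstep : ∀ k, (γ⁻¹) ^ k * ‖stackMul (B ^ k) (stackMul B u)‖ =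
        γ * ((γ⁻¹) ^ (k + 1) * ‖stackMul (B ^ (k + 1)) u‖) := fun k => by
      rw [← stackMul_mul, ← pow_succ, pow_succ γ⁻¹]
      field_simp
    simp only [hstep]
    rw [← Finset.mul_sum]
    refine mul_le_mul_of_nonneg_left ?_ h0.le
    have h2 := Finset.sum_range_succ' (fun k => (γ⁻¹) ^ k * ‖stackMul (B ^ k) u‖) K
    rw [Finset.sum_range_succ] at h2
    have h3 : (γ⁻¹) ^ K * ‖stackMul (B ^ K) u‖ ≤ ‖u‖ := by
      have := mul_le_mul_of_nonneg_left (norm_stackMul_le (by positivity) hsum u)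
        (by positivity : 0 ≤ (γ⁻¹) ^ K)
      rwa [← mul_assoc, ← mul_pow, inv_mul_cancel₀ h0.ne', one_pow, one_mul] at this
    simp only [pow_zero, stackMul_one, one_mul] at h2
    linarith

/-! ### Averages and disagreements -/

theorem avg_add {N n : ℕ} (u v : Fin N → Dec n) : avg (u + v) = avg u + avg v := by
  simp [avg, Finset.sum_add_distrib]

theorem avg_sub {N n : ℕ} (u v : Fin N → Dec n) : avg (u - v) = avg u - avg v := by
  simp [avg, Finset.sum_sub_distrib, smul_sub]

theorem avg_smul {N n : ℕ} (c : ℝ) (u : Fin N → Dec n) : avg (c • u) = c • avg u := by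
  simp [avg, ← Finset.smul_sum, smul_comm c]

theorem norm_avg_le {N n : ℕ} (hN : 0 < N) (u : Fin N → Dec n) : ‖avg u‖ ≤ ‖u‖ := by
  have hN' : (0 : ℝ) < N := by positivity
  have h := (norm_sum_le Finset.univ u).trans
    (Finset.sum_le_card_nsmul _ _ ‖u‖ fun i _ => norm_le_pi_norm u i)
  rw [Finset.card_univ, Fintype.card_fin, nsmul_eq_mul] at h
  rw [avg, norm_smul, Real.norm_of_nonneg (by positivity), one_div, inv_mul_le_iff₀ hN']
  exact h

theorem norm_avg_le_of_forall {N n : ℕ} (hN : 0 < N) {u : Fin N → Dec n} {c : ℝ} (hc : 0 ≤ c)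
    (hu : ∀ i, ‖u i‖ ≤ c) : ‖avg u‖ ≤ c :=
  (norm_avg_le hN u).trans ((pi_norm_le_iff_of_nonneg hc).2 hu)

/-- The stacked disagreement `u - 𝟏 ū`. -/
noncomputable def deviation {N n : ℕ} (u : Fin N → Dec n) : Fin N → Dec n := u - fun _ => avg u

theorem deviation_add {N n : ℕ} (u v : Fin N → Dec n) :
    deviation (u + v) = deviation u + deviation v := by
  funext i
  simp only [deviation, Pi.sub_apply, Pi.add_apply, avg_add]
  abel

theorem norm_const_le {N n : ℕ} (c : Dec n) : ‖(fun _ : Fin N => c)‖ ≤ ‖c‖ :=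
  pi_norm_const_le c

theorem norm_deviation_le {N n : ℕ} (hN : 0 < N) (u : Fin N → Dec n) :
    ‖deviation u‖ ≤ 2 * ‖u‖ := by
  have h1 := norm_sub_le u (fun _ => avg u)
  have h2 := (norm_const_le (N := N) (avg u)).trans (norm_avg_le hN u)
  rw [deviation]
  linarith

theorem norm_deviation_le_disagreement {N n : ℕ} (u : Fin N → Dec n) :
    ‖deviation u‖ ≤ disagreement u := by
  refine (pi_norm_le_iff_of_nonneg (Real.sqrt_nonneg _)).2 fun i => ?_
  refine Real.le_sqrt_of_sq_le ?_
  exact Finset.single_le_sum (f := fun i => ‖u i - avg u‖ ^ 2) (fun _ _ => by positivity)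
    (Finset.mem_univ i)

theorem avg_stackMul {N n : ℕ} {W : Matrix (Fin N) (Fin N) ℝ} (hW : W ∈ doublyStochastic ℝ (Fin N))
    (u : Fin N → Dec n) : avg (stackMul W u) = avg u := by
  simp only [avg, stackMul]
  rw [Finset.sum_comm]
  simp only [← Finset.sum_smul, sum_col_of_mem_doublyStochastic hW, one_smul]

/-- `W` preserves averages, and `W - (1/N) 1 1ᵀ` has zero row sums, so it does not see the average
removed from `u`. -/
theorem deviation_stackMul {N n : ℕ} (hN : 0 < N) {W : Matrix (Fin N) (Fin N) ℝ}
    (hW : W ∈ doublyStochastic ℝ (Fin N)) (u : Fin N → Dec n) :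
    deviation (stackMul W u) =
      stackMul (Matrix.of fun i j => W i j - 1 / (N : ℝ)) (deviation u) := by
  have hN' : (N : ℝ) ≠ 0 := by positivity
  funext i
  have h1 : ∑ j, (W i j - 1 / (N : ℝ)) = 0 := by
    rw [Finset.sum_sub_distrib, sum_row_of_mem_doublyStochastic hW]
    simp [hN']
  have h2 : ∑ j, (W i j - 1 / (N : ℝ)) • deviation u j = ∑ j, W i j • u j - avg u := by
    simp only [deviation, Pi.sub_apply, smul_sub]
    rw [Finset.sum_sub_distrib, ← Finset.sum_smul, h1, zero_smul, sub_zero, avg, Finset.smul_sum,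
      ← Finset.sum_sub_distrib]
    simp only [sub_smul]
  simp only [deviation, Pi.sub_apply, avg_stackMul hW]
  simpa [stackMul, deviation] using h2.symm

theorem stackMul_const {N n : ℕ} {W : Matrix (Fin N) (Fin N) ℝ}
    (hW : W ∈ doublyStochastic ℝ (Fin N)) (c : Dec n) :
    stackMul W (fun _ => c) = fun _ => c := by
  funext i
  simp only [stackMul, ← Finset.sum_smul, sum_row_of_mem_doublyStochastic hW, one_smul]

/-- `W` fixes consensus vectors and is nonexpansive in the sup norm, so only the disagreement moves.
-/
theorem norm_stackMul_sub_self_le {N n : ℕ} {W : Matrix (Fin N) (Fin N) ℝ}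
    (hW : W ∈ doublyStochastic ℝ (Fin N)) (u : Fin N → Dec n) :
    ‖stackMul W u - u‖ ≤ 2 * ‖deviation u‖ := by
  have hu : u = deviation u + fun _ => avg u := by simp [deviation]
  have h1 : stackMul W u - u = stackMul W (deviation u) - deviation u := by
    conv_lhs => rw [hu, stackMul_add, stackMul_const hW]
    abel
  have h2 : ‖stackMul W (deviation u)‖ ≤ 1 * ‖deviation u‖ :=
    norm_stackMul_le zero_le_one (fun i => le_of_eq <| by
      simp only [abs_of_nonneg (nonneg_of_mem_doublyStochastic hW)]
      exact sum_row_of_mem_doublyStochastic hW i) _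
  rw [h1]
  linarith [norm_sub_le (stackMul W (deviation u)) (deviation u)]

/-! ### The network cost: mean gradient and optimality gap -/

/-- The average gradient `(1/N) ∑ i, ∇f_{i,t}(y)`. -/
noncomputable def meanGradient {N n : ℕ} (f : Fin N → ℕ → Dec n → ℝ) (t : ℕ) (y : Dec n) : Dec n :=
  avg fun i => gradient (f i t) y

/-- The optimality gap `f_t(y) - f_t(x⋆_t)`. -/
noncomputable def gap {N n : ℕ} (f : Fin N → ℕ → Dec n → ℝ) (xstar : ℕ → Dec n) (t : ℕ)
    (y : Dec n) : ℝ :=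
  totalCost f t y - totalCost f t (xstar t)

section Problem

variable {N n : ℕ} {L q η ζ : ℝ} {f : Fin N → ℕ → Dec n → ℝ} {xstar : ℕ → Dec n}

theorem smul_meanGradient (hN : 0 < N) (t : ℕ) (y : Dec n) :
    (N : ℝ) • meanGradient f t y = ∑ i, gradient (f i t) y := by
  have : (N : ℝ) ≠ 0 := by positivity
  rw [meanGradient, avg, smul_smul, mul_one_div_cancel this, one_smul]

theorem OnlineProblem.hasGradientAt_totalCost (hf : OnlineProblem L q η ζ f xstar) (hN : 0 < N)
    (t : ℕ) (y : Dec n) :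
    HasGradientAt (totalCost f t) ((N : ℝ) • meanGradient f t y) y := by
  rw [smul_meanGradient hN, hasGradientAt_iff_hasFDerivAt, map_sum]
  have := HasFDerivAt.sum (u := Finset.univ) fun i _ =>
    ((hf.lipschitz_gradient i t).1 y).hasGradientAt.hasFDerivAt
  refine this.congr_of_eventuallyEq (Eventually.of_forall fun z => ?_)
  simp [totalCost]

theorem OnlineProblem.norm_meanGradient_sub_le (hf : OnlineProblem L q η ζ f xstar) (hN : 0 < N)
    (hL : 0 < L) (t : ℕ) (x y : Dec n) :
    ‖meanGradient f t x - meanGradient f t y‖ ≤ L * ‖x - y‖ := by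
  rw [meanGradient, meanGradient, ← avg_sub]
  exact norm_avg_le_of_forall hN (by positivity) fun i => (hf.lipschitz_gradient i t).2 x y

theorem OnlineProblem.norm_meanGradient_succ_sub_le (hf : OnlineProblem L q η ζ f xstar)
    (hN : 0 < N) (hη : 0 ≤ η) (t : ℕ) (x : Dec n) :
    ‖meanGradient f (t + 1) x - meanGradient f t x‖ ≤ η := by
  rw [meanGradient, meanGradient, ← avg_sub]
  exact norm_avg_le_of_forall hN hη fun i => hf.gradient_variation i t x

theorem OnlineProblem.lipschitzGradient_totalCost (hf : OnlineProblem L q η ζ f xstar)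
    (hN : 0 < N) (hL : 0 < L) (t : ℕ) : LipschitzGradient (N * L) (totalCost f t) := by
  refine ⟨fun y => (hf.hasGradientAt_totalCost hN t y).differentiableAt, fun x y => ?_⟩
  rw [(hf.hasGradientAt_totalCost hN t x).gradient, (hf.hasGradientAt_totalCost hN t y).gradient,
    ← smul_sub, norm_smul, Real.norm_of_nonneg (Nat.cast_nonneg N), mul_assoc]
  exact mul_le_mul_of_nonneg_left (hf.norm_meanGradient_sub_le hN hL t x y) (Nat.cast_nonneg N)

theorem OnlineProblem.totalCost_quadratic_le (hf : OnlineProblem L q η ζ f xstar) (hN : 0 < N)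
    (t : ℕ) (x y : Dec n) :
    totalCost f t x + N * (inner ℝ (meanGradient f t x) (y - x) + q / 2 * ‖y - x‖ ^ 2) ≤
      totalCost f t y := by
  have h := Finset.sum_le_sum fun i (_ : i ∈ Finset.univ) =>
    (hf.strong_convexity i t).quadratic_le (hf.lipschitz_gradient i t).1 x y
  rw [Finset.sum_add_distrib, Finset.sum_add_distrib, ← sum_inner, ← smul_meanGradient hN,
    real_inner_smul_left, Finset.sum_const, Finset.card_univ, Fintype.card_fin, nsmul_eq_mul] at h
  rw [totalCost, totalCost]
  linarith

theorem OnlineProblem.meanGradient_minimizer (hf : OnlineProblem L q η ζ f xstar) (hN : 0 < N)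
    (t : ℕ) : meanGradient f t (xstar t) = 0 := by
  have hN' : (N : ℝ) ≠ 0 := by positivity
  have hmin : IsLocalMin (totalCost f t) (xstar t) :=
    Eventually.of_forall fun x => hf.minimizer t x
  have h := hmin.hasFDerivAt_eq_zero (hf.hasGradientAt_totalCost hN t (xstar t)).hasFDerivAt
  simpa [hN'] using h

theorem OnlineProblem.norm_meanGradient_le (hf : OnlineProblem L q η ζ f xstar) (hN : 0 < N)
    (hL : 0 < L) (t : ℕ) (y : Dec n) : ‖meanGradient f t y‖ ≤ L * ‖y - xstar t‖ := by
  simpa [hf.meanGradient_minimizer hN t] using hf.norm_meanGradient_sub_le hN hL t y (xstar t)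

theorem OnlineProblem.gap_nonneg (hf : OnlineProblem L q η ζ f xstar) (t : ℕ) (y : Dec n) :
    0 ≤ gap f xstar t y := sub_nonneg.2 (hf.minimizer t y)

theorem OnlineProblem.sq_dist_minimizer_le (hf : OnlineProblem L q η ζ f xstar) (hN : 0 < N)
    (hq : 0 < q) (t : ℕ) (y : Dec n) : q / 2 * ‖y - xstar t‖ ^ 2 ≤ gap f xstar t y := by
  have h := hf.totalCost_quadratic_le hN t (xstar t) y
  rw [hf.meanGradient_minimizer hN t, inner_zero_left, zero_add] at h
  have hN' : (1 : ℝ) ≤ N := by exact_mod_cast hN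
  have : 0 ≤ q / 2 * ‖y - xstar t‖ ^ 2 := by positivity
  rw [gap]
  nlinarith

theorem OnlineProblem.gap_le_sq_dist (hf : OnlineProblem L q η ζ f xstar) (hN : 0 < N)
    (hL : 0 < L) (t : ℕ) (y : Dec n) : gap f xstar t y ≤ N * L / 2 * ‖y - xstar t‖ ^ 2 := by
  have h := le_quadratic_of_lipschitz_gradient (hf.lipschitzGradient_totalCost hN hL t) (xstar t) y
  rw [(hf.hasGradientAt_totalCost hN t _).gradient, hf.meanGradient_minimizer hN t, smul_zero,
    inner_zero_left] at h
  rw [gap]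
  linarith

/-- The Polyak–Łojasiewicz inequality: the strong convexity lower bound at `y`, evaluated at the
minimizer, is optimized over the distance `r`. -/
theorem OnlineProblem.gap_le_sq_meanGradient (hf : OnlineProblem L q η ζ f xstar) (hN : 0 < N)
    (hq : 0 < q) (t : ℕ) (y : Dec n) :
    q * gap f xstar t y ≤ N / 2 * ‖meanGradient f t y‖ ^ 2 := by
  have h := hf.totalCost_quadratic_le hN t y (xstar t)
  have h1 := neg_le_of_abs_le (abs_real_inner_le_norm (meanGradient f t y) (xstar t - y))
  have hN' : (0 : ℝ) < N := by positivity
  set g := ‖meanGradient f t y‖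
  set r := ‖xstar t - y‖
  have h2 : gap f xstar t y ≤ N * (g * r - q / 2 * r ^ 2) := by
    rw [gap]
    nlinarith
  have h3 : q * (g * r - q / 2 * r ^ 2) ≤ g ^ 2 / 2 := by nlinarith [sq_nonneg (g - q * r)]
  nlinarith

/-- Inexact descent, with `r` measuring the error of the direction. Of the decrease `a * g ^ 2`, a
quarter pays for the cross term `b * g * r` by Young's inequality and a quarter for the second-order
term by the bound on `α`; the remaining half becomes the contraction through Polyak–Łojasiewicz. -/
theorem OnlineProblem.gap_step_le (hf : OnlineProblem L q η ζ f xstar) (hN : 0 < N) (hL : 0 < L)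
    (hq : 0 < q) {a b α r : ℝ} (ha : 0 < a) (hα : 0 < α)
    (hαL : α * (L * b ^ 2) ≤ a / 4) (t : ℕ) {y p : Dec n}
    (h1 : a * ‖meanGradient f t y‖ ^ 2 - b * ‖meanGradient f t y‖ * r ≤
      inner ℝ (meanGradient f t y) p)
    (h2 : ‖p‖ ≤ b * (‖meanGradient f t y‖ + r)) :
    gap f xstar t (y - α • p) ≤
      (1 - α * (a * q)) * gap f xstar t y + α * (N * (b ^ 2 / a + a / 4) * r ^ 2) := by
  have hN' : (0 : ℝ) < N := by positivity
  have hd := le_quadratic_of_lipschitz_gradient (hf.lipschitzGradient_totalCost hN hL t) y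
    (y - α • p)
  rw [(hf.hasGradientAt_totalCost hN t _).gradient, sub_sub_cancel_left, norm_neg, inner_neg_right,
    real_inner_smul_left, real_inner_smul_right, norm_smul, Real.norm_of_nonneg hα.le] at hd
  have hpl := hf.gap_le_sq_meanGradient hN hq t y
  set g := ‖meanGradient f t y‖
  have h3 : ‖p‖ ^ 2 ≤ b ^ 2 * (2 * g ^ 2 + 2 * r ^ 2) := by
    have := pow_le_pow_left₀ (norm_nonneg p) h2 2
    nlinarith [mul_nonneg (sq_nonneg b) (sq_nonneg (g - r))]
  have h4 : L / 2 * α * ‖p‖ ^ 2 ≤ a / 4 * (g ^ 2 + r ^ 2) := by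
    have e1 := mul_le_mul_of_nonneg_left h3 (by positivity : 0 ≤ L / 2 * α)
    have e2 := mul_le_mul_of_nonneg_right hαL (by positivity : 0 ≤ g ^ 2 + r ^ 2)
    nlinarith
  have h5 : b * g * r ≤ a / 4 * g ^ 2 + b ^ 2 / a * r ^ 2 := by
    have e : a / 4 * g ^ 2 + b ^ 2 / a * r ^ 2 - b * g * r = (a * g / 2 - b * r) ^ 2 / a := by
      field_simp
      ring
    have : 0 ≤ (a * g / 2 - b * r) ^ 2 / a := by positivity
    linarith
  have h6 : -inner ℝ (meanGradient f t y) p + L / 2 * α * ‖p‖ ^ 2 ≤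
      -(a / 2) * g ^ 2 + (b ^ 2 / a + a / 4) * r ^ 2 := by nlinarith
  have h7 := mul_le_mul_of_nonneg_left h6 (by positivity : 0 ≤ α * N)
  have h8 := mul_le_mul_of_nonneg_left hpl (by positivity : 0 ≤ α * a)
  simp only [gap] at h8 ⊢
  nlinarith

/-- The difference of consecutive costs is `N * η`-Lipschitz; it is compared at `y` and at the old
minimizer, whose gap for the new cost is at most quadratic in `ζ`. -/
theorem OnlineProblem.gap_succ_le (hf : OnlineProblem L q η ζ f xstar) (hN : 0 < N) (hL : 0 < L)
    (hη : 0 ≤ η) (t : ℕ) (y : Dec n) :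
    gap f xstar (t + 1) y ≤
      gap f xstar t y + N * η * ‖y - xstar t‖ + N * L / 2 * ζ ^ 2 := by
  have hN' : (0 : ℝ) < N := by positivity
  have hder : ∀ w ∈ Set.univ, HasFDerivWithinAt (fun w => totalCost f (t + 1) w - totalCost f t w)
      (InnerProductSpace.toDual ℝ (Dec n)
        ((N : ℝ) • (meanGradient f (t + 1) w - meanGradient f t w))) Set.univ w := fun w _ => by
    rw [smul_sub, map_sub]
    exact ((hf.hasGradientAt_totalCost hN (t + 1) w).hasFDerivAt.sub
      (hf.hasGradientAt_totalCost hN t w).hasFDerivAt).hasFDerivWithinAt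
  have h1 := convex_univ.norm_image_sub_le_of_norm_hasFDerivWithin_le (C := N * η) hder
    (fun w _ => by
      rw [LinearIsometryEquiv.norm_map, norm_smul, Real.norm_of_nonneg hN'.le]
      exact mul_le_mul_of_nonneg_left (hf.norm_meanGradient_succ_sub_le hN hη t w) hN'.le)
    (Set.mem_univ (xstar t)) (Set.mem_univ y)
  have h2 := (le_abs_self _).trans h1
  have h3 := hf.gap_le_sq_dist hN hL (t + 1) (xstar t)
  rw [norm_sub_rev] at h3
  have h4 := mul_le_mul_of_nonneg_left (pow_le_pow_left₀ (norm_nonneg _)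
    (hf.minimizer_variation t) 2) (by positivity : 0 ≤ N * L / 2)
  simp only [gap] at *
  linarith

end Problem

/-! ### Small-gain argument for the coupled recursion -/

/-- The gap variable `ψ` contracts only by `c * α`, yet is perturbed at the larger order `√α`. This
is harmless: the other errors contract at a rate independent of `α` and feel `ψ` only at order `α`.
-/
theorem exists_coupled_contraction {γ c C : ℝ} (hγ0 : 0 < γ) (hγ1 : γ < 1) (hc : 0 < c)
    (hC : 0 < C) :
    ∃ αbar θ w K : ℝ, 0 < αbar ∧ 0 < θ ∧ 1 ≤ w ∧ 0 < K ∧ ∀ α, 0 < α → α < αbar →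
      ∃ l : ℝ, 0 < l ∧ l < 1 ∧ ∀ ψ m s x Δ h ψ' m' s' x' : ℝ,
        0 ≤ ψ → 0 ≤ m → 0 ≤ s → 0 ≤ x → 0 ≤ h → Δ ≤ C * (ψ + m + s + x) →
        ψ' ≤ (1 - c * α) * ψ + √α * (C * (m + s + x)) + C * h →
        m' ≤ γ * m + C * (s + x) + α * (C * Δ) + C * h →
        s' ≤ γ * s + C * x + α * (C * Δ) + C * h →
        x' ≤ γ * x + α * (C * Δ) →
        ψ' + θ * (m' + w * s' + w ^ 2 * x') ≤ l * (ψ + θ * (m + w * s + w ^ 2 * x)) + K * h := by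
  -- The powers of `w` make each error pay for the ones it drives: `x` drives `s` and `m`, and `s`
  -- drives `m`.
  set w : ℝ := 1 + 4 * C / (1 - γ) with hw
  have hγ : 0 < 1 - γ := by linarith
  have hw1 : 1 ≤ w := by rw [hw]; linarith [(by positivity : 0 ≤ 4 * C / (1 - γ))]
  have hwC : 4 * C ≤ w * (1 - γ) := by
    rw [hw, add_mul, div_mul_cancel₀ _ hγ.ne']; linarith
  set K : ℝ := (C + C ^ 2) * (1 + w + w ^ 2) with hK
  have hw0 : 0 < w := by linarith
  have hK0 : 0 < K := by positivity
  -- With `θ * K = c / 2`, the feedback of `ψ` through the weighted errors costs exactly half of its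
  -- contraction `c * α`.
  set θ : ℝ := c / (2 * K) with hθ
  have hθ0 : 0 < θ := by positivity
  have hθK : θ * K = c / 2 := by rw [hθ]; field_simp
  set μ : ℝ := (1 - γ) / 2 with hμ
  have hμ0 : 0 < μ := by positivity
  refine ⟨min ((θ * μ / (4 * K)) ^ 2) (μ / (4 * K)), θ, w, K * (1 + θ), by positivity, hθ0, hw1,
    by positivity, fun α hα hαb => ?_⟩
  have hα1 : √α * K ≤ θ * μ / 4 := by
    have h1 : √α ≤ θ * μ / (4 * K) :=
      Real.sqrt_le_iff.2 ⟨by positivity, (hαb.trans_le (min_le_left _ _)).le⟩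
    have h2 := mul_le_mul_of_nonneg_right h1 hK0.le
    have h3 : θ * μ / (4 * K) * K = θ * μ / 4 := by field_simp
    linarith
  have hα2 : α * K ≤ μ / 4 := by
    have h2 := mul_le_mul_of_nonneg_right (hαb.trans_le (min_le_right _ _)).le hK0.le
    have h3 : μ / (4 * K) * K = μ / 4 := by field_simp
    linarith
  refine ⟨max (1 - c * α / 2) (1 - μ / 2), lt_max_of_lt_right (by rw [hμ]; linarith),
    max_lt (by linarith [mul_pos hc hα]) (by linarith), ?_⟩
  intro ψ m s x Δ h ψ' m' s' x' hψ hm hs hx hh hΔ h1 h2 h3 h4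
  set E := m + w * s + w ^ 2 * x with hE
  have hE0 : 0 ≤ E := by positivity
  have hsum : m + s + x ≤ E := by
    have e1 := mul_le_mul_of_nonneg_right hw1 hs
    have e2 := mul_le_mul_of_nonneg_right (one_le_pow₀ hw1 (n := 2)) hx
    linarith
  have hCK : C ≤ K := by
    rw [hK]
    have : 0 ≤ C * (w + w ^ 2) + C ^ 2 * (1 + w + w ^ 2) := by positivity
    linarith
  have hψ' : ψ' ≤ (1 - c * α) * ψ + √α * K * E + K * h := by
    have e1 : C * (m + s + x) ≤ K * E := mul_le_mul hCK hsum (by positivity) hK0.le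
    have e2 := mul_le_mul_of_nonneg_left e1 (Real.sqrt_nonneg α)
    have e3 := mul_le_mul_of_nonneg_right hCK hh
    linarith
  have hE' : m' + w * s' + w ^ 2 * x' ≤ (1 - μ) * E + α * K * (ψ + E) + K * h := by
    have e1 : C * Δ ≤ C ^ 2 * (ψ + E) := by
      have : C * Δ ≤ C * (C * (ψ + E)) :=
        mul_le_mul_of_nonneg_left (hΔ.trans (mul_le_mul_of_nonneg_left (by linarith) hC.le)) hC.le
      linarith
    have e2 : (1 + w + w ^ 2) * (α * (C * Δ)) ≤ α * K * (ψ + E) := by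
      have a1 := mul_le_mul_of_nonneg_left e1 (by positivity : 0 ≤ (1 + w + w ^ 2) * α)
      have a2 : 0 ≤ (1 + w + w ^ 2) * α * (C * (ψ + E)) := by positivity
      rw [hK]
      linarith
    have e3 : (C + w * C) * h ≤ K * h := by
      refine mul_le_mul_of_nonneg_right ?_ hh
      have : 0 ≤ C * w ^ 2 + C ^ 2 * (1 + w + w ^ 2) := by positivity
      rw [hK]
      linarith
    have e4 := mul_le_mul_of_nonneg_left h3 hw0.le
    have e5 := mul_le_mul_of_nonneg_left h4 (sq_nonneg w)
    have e6 := mul_le_mul_of_nonneg_right hwC hs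
    have e7 := mul_le_mul_of_nonneg_right hwC (mul_nonneg hw0.le hx)
    have e8 : C * x ≤ w * C * x := by
      have := mul_le_mul_of_nonneg_right hw1 (mul_nonneg hC.le hx)
      linarith
    have e9 : γ * m + (C + w * γ) * s + (C + w * C + w ^ 2 * γ) * x ≤ (1 - μ) * E := by
      have : γ * m ≤ (1 - μ) * m := mul_le_mul_of_nonneg_right (by rw [hμ]; linarith) hm
      have p1 : 0 ≤ C * s := by positivity
      have p2 : 0 ≤ w * C * x := by positivity
      rw [hE, hμ] at *
      linarith
    linarith
  have hmul := mul_le_mul_of_nonneg_left hE' hθ0.le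
  have k1 := mul_le_mul_of_nonneg_right hα1 hE0
  have k2 := mul_le_mul_of_nonneg_left (mul_le_mul_of_nonneg_right hα2 hE0) hθ0.le
  have k3 : θ * (α * K * ψ) = c * α / 2 * ψ := by
    rw [show θ * (α * K * ψ) = θ * K * α * ψ by ring, hθK]; ring
  have k4 := mul_le_mul_of_nonneg_right (le_max_left (1 - c * α / 2) (1 - μ / 2)) hψ
  have k5 := mul_le_mul_of_nonneg_right (le_max_right (1 - c * α / 2) (1 - μ / 2))
    (mul_nonneg hθ0.le hE0)
  linarith

/-! ### The preconditioned update direction -/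

theorem norm_le_of_weighted {n : ℕ} {b : ℝ} (hb : 0 ≤ b) {m d : Dec n}
    (hd : ∀ k, |d k| ≤ b * |m k|) : ‖d‖ ≤ b * ‖m‖ := by
  refine abs_le_of_sq_le_sq' ?_ (by positivity) |>.2
  rw [mul_pow, EuclideanSpace.real_norm_sq_eq, EuclideanSpace.real_norm_sq_eq, Finset.mul_sum]
  refine Finset.sum_le_sum fun k _ => ?_
  have := pow_le_pow_left₀ (abs_nonneg _) (hd k) 2
  rwa [mul_pow, sq_abs, sq_abs] at this

theorem inner_weighted_ge {n : ℕ} {a b : ℝ} (ha : 0 ≤ a) (hb : 0 ≤ b) {m d y : Dec n}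
    {w : Fin n → ℝ} (hw : ∀ k, a ≤ w k ∧ w k ≤ b) (hd : ∀ k, d k = w k * m k) :
    a * ‖y‖ ^ 2 - b * ‖y‖ * ‖m - y‖ ≤ inner ℝ y d := by
  -- The weights act separately on `y` and on the error `m - y`: `d - e` has coordinates `w k * y
  -- k`.
  set e : Dec n := WithLp.toLp 2 fun k => w k * (m - y) k with he
  have he1 : ‖e‖ ≤ b * ‖m - y‖ := norm_le_of_weighted hb fun k => by
    rw [he, abs_mul, abs_of_nonneg (ha.trans (hw k).1)]
    exact mul_le_mul_of_nonneg_right (hw k).2 (abs_nonneg _)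
  have h1 : inner ℝ y (d - e) = ∑ k, w k * y k ^ 2 := by
    rw [PiLp.inner_apply]
    refine Finset.sum_congr rfl fun k _ => ?_
    simp [he, hd]
    ring
  have h2 : a * ‖y‖ ^ 2 ≤ inner ℝ y (d - e) := by
    rw [h1, EuclideanSpace.real_norm_sq_eq, Finset.mul_sum]
    exact Finset.sum_le_sum fun k _ => mul_le_mul_of_nonneg_right (hw k).1 (sq_nonneg _)
  rw [inner_sub_right] at h2
  have h3 := neg_le_of_abs_le (abs_real_inner_le_norm y e)
  have h4 := mul_le_mul_of_nonneg_left he1 (norm_nonneg y)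
  linarith

section Algorithm

variable {N n : ℕ} {p : Tuning} {z : AgentState N n}

theorem nextV_nonneg (hβ : p.β₂ ∈ Set.Ioo (0 : ℝ) 1) (hG : 0 < p.G) (hv : ∀ i k, 0 ≤ z.v i k)
    (i : Fin N) (k : Fin n) : 0 ≤ nextV p z i k :=
  le_min (add_nonneg (mul_nonneg hβ.1.le (hv i k))
    (mul_nonneg (sub_nonneg.2 hβ.2.le) (mul_self_nonneg _))) hG.le

theorem nextV_le (i : Fin N) (k : Fin n) : nextV p z i k ≤ p.G := min_le_right _ _

theorem inv_sqrt_nextV_mem (hβ : p.β₂ ∈ Set.Ioo (0 : ℝ) 1) (hG : 0 < p.G) (hε : 0 < p.ε)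
    (hv : ∀ i k, 0 ≤ z.v i k) (i : Fin N) (k : Fin n) :
    1 / √(p.G + p.ε) ≤ 1 / √(nextV p z i k + p.ε) ∧
      1 / √(nextV p z i k + p.ε) ≤ 1 / √p.ε := by
  have h0 := nextV_nonneg hβ hG hv i k
  have h1 : nextV p z i k ≤ p.G := nextV_le i k
  constructor
  · exact one_div_le_one_div_of_le (Real.sqrt_pos.2 (by linarith)) (Real.sqrt_le_sqrt (by linarith))
  · exact one_div_le_one_div_of_le (Real.sqrt_pos.2 hε) (Real.sqrt_le_sqrt (by linarith))

theorem nextD_apply (i : Fin N) (k : Fin n) :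
    nextD p z i k = 1 / √(nextV p z i k + p.ε) * nextM p z i k := by
  simp [nextD, div_eq_inv_mul]

theorem norm_nextD_le (hβ : p.β₂ ∈ Set.Ioo (0 : ℝ) 1) (hG : 0 < p.G) (hε : 0 < p.ε)
    (hv : ∀ i k, 0 ≤ z.v i k) (y : Dec n) :
    ‖nextD p z‖ ≤ 1 / √p.ε * (‖y‖ + ‖nextM p z - fun _ => y‖) := by
  refine (pi_norm_le_iff_of_nonneg (by positivity)).2 fun i => ?_
  have h1 : ‖nextD p z i‖ ≤ 1 / √p.ε * ‖nextM p z i‖ :=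
    norm_le_of_weighted (by positivity) fun k => by
      rw [nextD_apply, abs_mul, abs_of_nonneg (by positivity)]
      exact mul_le_mul_of_nonneg_right (inv_sqrt_nextV_mem hβ hG hε hv i k).2 (abs_nonneg _)
  have h2 := norm_le_pi_norm (nextM p z - fun _ => y) i
  have h3 : ‖nextM p z i‖ ≤ ‖y‖ + ‖nextM p z i - y‖ := norm_le_insert' _ _
  exact h1.trans (mul_le_mul_of_nonneg_left (h3.trans (by simpa using h2)) (by positivity))

theorem inner_avg_nextD_ge (hN : 0 < N) (hβ : p.β₂ ∈ Set.Ioo (0 : ℝ) 1) (hG : 0 < p.G)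
    (hε : 0 < p.ε) (hv : ∀ i k, 0 ≤ z.v i k) (y : Dec n) :
    1 / √(p.G + p.ε) * ‖y‖ ^ 2 - 1 / √p.ε * ‖y‖ * ‖nextM p z - fun _ => y‖ ≤
      inner ℝ y (avg (nextD p z)) := by
  have hN' : (0 : ℝ) < N := by positivity
  have h := Finset.card_nsmul_le_sum Finset.univ (fun i => inner ℝ y (nextD p z i))
    (1 / √(p.G + p.ε) * ‖y‖ ^ 2 - 1 / √p.ε * ‖y‖ * ‖nextM p z - fun _ => y‖) fun i _ => by
      refine le_trans (sub_le_sub_left ?_ _) (inner_weighted_ge (by positivity) (by positivity)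
        (inv_sqrt_nextV_mem hβ hG hε hv i) (nextD_apply i))
      exact mul_le_mul_of_nonneg_left (norm_le_pi_norm (nextM p z - fun _ => y) i) (by positivity)
  rw [Finset.card_univ, Fintype.card_fin, nsmul_eq_mul] at h
  rwa [avg, real_inner_smul_right, inner_sum, one_div (N : ℝ), inv_mul_eq_div, le_div_iff₀ hN',
    mul_comm]

theorem nextX_eq (W : Matrix (Fin N) (Fin N) ℝ) :
    nextX W p z = stackMul W z.x - p.α • nextD p z := rfl

theorem avg_nextX {W : Matrix (Fin N) (Fin N) ℝ} (hW : W ∈ doublyStochastic ℝ (Fin N)) :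
    avg (nextX W p z) = avg z.x - p.α • avg (nextD p z) := by
  rw [nextX_eq, avg_sub, avg_stackMul hW, avg_smul]

end Algorithm

/-! ### One-step estimates along the algorithm -/

section Step

variable {N n : ℕ} {L q η ζ : ℝ} {f : Fin N → ℕ → Dec n → ℝ} {xstar : ℕ → Dec n}
  {W : Matrix (Fin N) (Fin N) ℝ} {p : Tuning} {z : AgentState N n} {t : ℕ}

theorem OnlineProblem.dist_minimizer_le (hf : OnlineProblem L q η ζ f xstar) (hN : 0 < N)
    (hq : 0 < q) (t : ℕ) (y : Dec n) : ‖y - xstar t‖ ≤ √(2 / q) * √(gap f xstar t y) := by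
  rw [← Real.sqrt_mul (by positivity)]
  refine Real.le_sqrt_of_sq_le ?_
  have h := mul_le_mul_of_nonneg_left (hf.sq_dist_minimizer_le hN hq t y)
    (by positivity : 0 ≤ 2 / q)
  have e : 2 / q * (q / 2 * ‖y - xstar t‖ ^ 2) = ‖y - xstar t‖ ^ 2 := by field_simp
  rwa [e] at h

/-- Passing to the square root makes the drift additive: a bound `ψ ^ 2 + A * η * ψ + B ^ 2 * ζ ^ 2`
lies below `(ψ + A * η + B * ζ) ^ 2`. -/
theorem OnlineProblem.sqrt_gap_succ_le (hf : OnlineProblem L q η ζ f xstar) (hN : 0 < N)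
    (hL : 0 < L) (hq : 0 < q) (hη : 0 ≤ η) (hζ : 0 ≤ ζ) (t : ℕ) (y : Dec n) :
    √(gap f xstar (t + 1) y) ≤
      √(gap f xstar t y) + (N * √(2 / q) + √(N * L / 2)) * (η + ζ) := by
  refine Real.sqrt_le_iff.2 ⟨by positivity, ?_⟩
  have h1 := hf.gap_succ_le hN hL hη t y
  have h2 := mul_le_mul_of_nonneg_left (hf.dist_minimizer_le hN hq t y)
    (by positivity : 0 ≤ N * η)
  have h3 := Real.sq_sqrt (hf.gap_nonneg t y)
  have h4 := Real.sq_sqrt (by positivity : 0 ≤ N * L / 2)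
  set ψ := √(gap f xstar t y)
  have hψ : 0 ≤ ψ := Real.sqrt_nonneg _
  set A := N * √(2 / q) with hA
  set B := √(N * L / 2)
  have hA0 : 0 ≤ A := by positivity
  have hB0 : 0 ≤ B := Real.sqrt_nonneg _
  have e1 : (A * η + B * ζ) ≤ (A + B) * (η + ζ) := by
    have : 0 ≤ A * ζ + B * η := by positivity
    linarith
  have e2 := pow_le_pow_left₀ (by positivity) (add_le_add_right e1 ψ) 2
  refine le_trans ?_ e2
  have e3 : 0 ≤ ψ * (A * η) + 2 * ψ * (B * ζ) + (A * η) ^ 2 + 2 * (A * η) * (B * ζ) := by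
    positivity
  rw [← h4] at h1
  nlinarith

theorem OnlineProblem.sqrt_gap_step_le (hf : OnlineProblem L q η ζ f xstar) (hN : 0 < N)
    (hL : 0 < L) (hq : 0 < q) {a b α r : ℝ} (ha : 0 < a) (hα : 0 < α) (hr : 0 ≤ r)
    (hαL : α * (L * b ^ 2) ≤ a / 4) (hαq : α * (a * q) ≤ 1) (t : ℕ) {y d : Dec n}
    (h1 : a * ‖meanGradient f t y‖ ^ 2 - b * ‖meanGradient f t y‖ * r ≤
      inner ℝ (meanGradient f t y) d)
    (h2 : ‖d‖ ≤ b * (‖meanGradient f t y‖ + r)) :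
    √(gap f xstar t (y - α • d)) ≤
      (1 - a * q / 2 * α) * √(gap f xstar t y) + √α * (√(N * (b ^ 2 / a + a / 4)) * r) := by
  have h := hf.gap_step_le hN hL hq ha hα hαL t h1 h2
  have h3 := Real.sq_sqrt (hf.gap_nonneg t y)
  have h4 := Real.sq_sqrt (by positivity : 0 ≤ N * (b ^ 2 / a + a / 4))
  have h5 := Real.sq_sqrt hα.le
  set ψ := √(gap f xstar t y)
  have hψ : 0 ≤ ψ := Real.sqrt_nonneg _
  set κ := √(N * (b ^ 2 / a + a / 4))
  have hκ : 0 ≤ κ := Real.sqrt_nonneg _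
  have h6 : 0 ≤ 1 - a * q / 2 * α := by linarith [mul_pos hα (mul_pos ha hq)]
  refine Real.sqrt_le_iff.2 ⟨by positivity, h.trans ?_⟩
  rw [← h3, ← h4]
  have e1 : 0 ≤ (a * q / 2 * α) ^ 2 * ψ ^ 2 := by positivity
  have e2 : 0 ≤ 2 * ((1 - a * q / 2 * α) * ψ) * (√α * (κ * r)) := by positivity
  have e3 : (√α * (κ * r)) ^ 2 = α * (κ ^ 2 * r ^ 2) := by rw [mul_pow, h5]; ring
  rw [add_sq, e3]
  nlinarith

/-- The momentum is compared with the mean gradient at the average iterate. By the tracking identity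
`hz`, the average tracker misses this target only through the disagreement of the iterates. -/
theorem norm_nextM_sub_meanGradient_le (hf : OnlineProblem L q η ζ f xstar) (hN : 0 < N)
    (hL : 0 < L) (hβ : p.β₁ ∈ Set.Ioo (0 : ℝ) 1)
    (hz : avg z.s = avg fun i => gradient (f i t) (z.x i)) :
    ‖nextM p z - fun _ => meanGradient f t (avg z.x)‖ ≤
      p.β₁ * ‖z.m - fun _ => meanGradient f t (avg z.x)‖ +
        (‖deviation z.s‖ + L * ‖deviation z.x‖) := by
  set μ := meanGradient f t (avg z.x) with hμ
  have h1 : ‖avg z.s - μ‖ ≤ L * ‖deviation z.x‖ := by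
    rw [hz, hμ, meanGradient, ← avg_sub]
    refine norm_avg_le_of_forall hN (by positivity) fun i => ?_
    exact ((hf.lipschitz_gradient i t).2 _ _).trans
      (mul_le_mul_of_nonneg_left (norm_le_pi_norm (deviation z.x) i) hL.le)
  have h2 : ‖z.s - fun _ => μ‖ ≤ ‖deviation z.s‖ + L * ‖deviation z.x‖ := by
    have e : (z.s - fun _ => μ) = deviation z.s + fun _ => avg z.s - μ := by
      funext i; simp [deviation]
    rw [e]
    exact (norm_add_le _ _).trans (add_le_add_right ((norm_const_le _).trans h1) _)
  have e : (nextM p z - fun _ => μ) =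
      p.β₁ • (z.m - fun _ => μ) + (1 - p.β₁) • (z.s - fun _ => μ) := by
    funext i
    simp only [nextM, Pi.sub_apply, Pi.add_apply, Pi.smul_apply]
    module
  rw [e]
  refine (norm_add_le _ _).trans ?_
  rw [norm_smul, norm_smul, Real.norm_of_nonneg hβ.1.le,
    Real.norm_of_nonneg (sub_nonneg.2 hβ.2.le)]
  have h3 := mul_le_of_le_one_left (norm_nonneg (z.s - fun _ => μ))
    (by linarith [hβ.1] : 1 - p.β₁ ≤ 1)
  linarith

theorem norm_nextM_sub_meanGradient_succ_le (hf : OnlineProblem L q η ζ f xstar) (hN : 0 < N)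
    (hL : 0 < L) (hη : 0 ≤ η) (hα : 0 ≤ p.α) (hW : W ∈ doublyStochastic ℝ (Fin N)) :
    ‖nextM p z - fun _ => meanGradient f (t + 1) (avg (nextX W p z))‖ ≤
      ‖nextM p z - fun _ => meanGradient f t (avg z.x)‖ + L * (p.α * ‖nextD p z‖) + η := by
  have h1 := hf.norm_meanGradient_succ_sub_le hN hη t (avg (nextX W p z))
  have h2 := hf.norm_meanGradient_sub_le hN hL t (avg (nextX W p z)) (avg z.x)
  rw [avg_nextX hW, sub_sub_cancel_left, norm_neg, norm_smul, Real.norm_of_nonneg hα,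
    ← avg_nextX hW] at h2
  have h3 := mul_le_mul_of_nonneg_left (mul_le_mul_of_nonneg_left (norm_avg_le hN (nextD p z)) hα)
    hL.le
  set μ := meanGradient f t (avg z.x)
  set ν := meanGradient f t (avg (nextX W p z))
  set μ' := meanGradient f (t + 1) (avg (nextX W p z))
  have e : (nextM p z - fun _ => μ') = (nextM p z - fun _ => μ) - fun _ => (μ' - ν) + (ν - μ) := by
    funext i; simp
  rw [e]
  have h4 := norm_sub_le (nextM p z - fun _ => μ) (fun _ => (μ' - ν) + (ν - μ))
  have h5 := (norm_const_le (N := N) ((μ' - ν) + (ν - μ))).trans (norm_add_le _ _)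
  linarith

theorem norm_nextX_sub_le (hα : 0 ≤ p.α) (hW : W ∈ doublyStochastic ℝ (Fin N)) :
    ‖nextX W p z - z.x‖ ≤ 2 * ‖deviation z.x‖ + p.α * ‖nextD p z‖ := by
  have e : nextX W p z - z.x = (stackMul W z.x - z.x) - p.α • nextD p z := by
    rw [nextX_eq]; abel
  rw [e]
  refine (norm_sub_le _ _).trans ?_
  rw [norm_smul, Real.norm_of_nonneg hα]
  linarith [norm_stackMul_sub_self_le hW z.x]

theorem norm_gradient_increment_le (hf : OnlineProblem L q η ζ f xstar) (hL : 0 < L) (hη : 0 ≤ η)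
    (x x' : Fin N → Dec n) (t : ℕ) :
    ‖fun i => gradient (f i (t + 1)) (x' i) - gradient (f i t) (x i)‖ ≤ L * ‖x' - x‖ + η := by
  refine (pi_norm_le_iff_of_nonneg (by positivity)).2 fun i => ?_
  have h1 := hf.gradient_variation i t (x' i)
  have h2 := ((hf.lipschitz_gradient i t).2 (x' i) (x i)).trans
    (mul_le_mul_of_nonneg_left (norm_le_pi_norm (x' - x) i) hL.le)
  have h3 := norm_sub_le_norm_sub_add_norm_sub (gradient (f i (t + 1)) (x' i))
    (gradient (f i t) (x' i)) (gradient (f i t) (x i))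
  linarith

theorem contractive_deviation_stackMul_add_le {γ C : ℝ} {P : (Fin N → Dec n) → ℝ} (hN : 0 < N)
    (hW : W ∈ doublyStochastic ℝ (Fin N)) (hC : 0 ≤ C)
    (hadd : ∀ u v, P (u + v) ≤ P u + P v) (hle : ∀ u, P u ≤ C * ‖u‖)
    (hcontr : ∀ u, P (stackMul (Matrix.of fun i j => W i j - 1 / (N : ℝ)) u) ≤ γ * P u)
    (u v : Fin N → Dec n) :
    P (deviation (stackMul W u + v)) ≤ γ * P (deviation u) + 2 * C * ‖v‖ := by
  rw [deviation_add, deviation_stackMul hN hW]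
  have h1 := hadd (stackMul (Matrix.of fun i j => W i j - 1 / (N : ℝ)) (deviation u)) (deviation v)
  have h2 := hcontr (deviation u)
  have h3 := (hle (deviation v)).trans (mul_le_mul_of_nonneg_left (norm_deviation_le hN v) hC)
  linarith

theorem gtadam_v_nonneg (hβ : p.β₂ ∈ Set.Ioo (0 : ℝ) 1) (hG : 0 < p.G) (x₀ : Fin N → Dec n)
    (t : ℕ) : ∀ i k, 0 ≤ (gtadam W p f x₀ t).v i k := by
  induction t with
  | zero => intro i k; simp [gtadam]
  | succ t ih => exact nextV_nonneg hβ hG ih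

/-- The tracking invariant: averaging removes `W`, and the gradient increments telescope. -/
theorem avg_gtadam_s (hW : W ∈ doublyStochastic ℝ (Fin N)) (x₀ : Fin N → Dec n) (t : ℕ) :
    avg (gtadam W p f x₀ t).s = avg fun i => gradient (f i t) ((gtadam W p f x₀ t).x i) := by
  induction t with
  | zero => rfl
  | succ t ih =>
    set z := gtadam W p f x₀ t
    have e : (gtadam W p f x₀ (t + 1)).s = stackMul W z.s +
        ((fun i => gradient (f i (t + 1)) (nextX W p z i)) - fun i => gradient (f i t) (z.x i)) :=
      rfl
    rw [e, avg_add, avg_stackMul hW, avg_sub, ih, add_sub_cancel]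
    rfl

end Step

/-! ### Input-to-state stability of the optimality gap -/

theorem le_geometric_of_recursion {V : ℕ → ℝ} {l D : ℝ} (hl0 : 0 ≤ l) (hl1 : l < 1)
    (hD : 0 ≤ D) (hV : ∀ t, V (t + 1) ≤ l * V t + D) (t : ℕ) :
    V t ≤ l ^ t * V 0 + D / (1 - l) := by
  have h1 : 0 < 1 - l := by linarith
  induction t with
  | zero =>
    have : 0 ≤ D / (1 - l) := by positivity
    simpa using this
  | succ t ih =>
    have h2 := mul_le_mul_of_nonneg_left ih hl0
    have h3 : l * (D / (1 - l)) + D = D / (1 - l) := by field_simp; ring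
    rw [pow_succ]
    linarith [hV t]

theorem sq_add_le_two_mul_Qconst {N : ℕ} (hN : 0 < N) (L η ζ : ℝ) :
    (η + ζ) ^ 2 ≤ 2 * Qconst N L η ζ := by
  have hN' : (1 : ℝ) ≤ N := by exact_mod_cast hN
  have h1 : 0 ≤ L ^ 2 * η ^ 2 / N := by positivity
  have h2 := mul_le_mul_of_nonneg_right hN' (sq_nonneg η)
  rw [Qconst]
  nlinarith [sq_nonneg (η - ζ)]

theorem Qconst_nonneg (N : ℕ) (L η ζ : ℝ) : 0 ≤ Qconst N L η ζ := by
  rw [Qconst]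
  positivity

/-- Exponential input-to-state stability of the optimality gap along GTAdam, with constants that do
not depend on the dimension, on `β₂`, or on the problem instance. -/
theorem exists_gap_gtadam_le {N : ℕ} (hN : 0 < N) {W : Matrix (Fin N) (Fin N) ℝ}
    (hW : NetworkStructure W) {L q β₁ ε G : ℝ} (hL : 0 < L) (hq : 0 < q)
    (hβ₁ : β₁ ∈ Set.Ioo (0 : ℝ) 1) (hε : 0 < ε) (hG : 0 < G) :
    ∃ αbar : ℝ, 0 < αbar ∧ ∀ α : ℝ, 0 < α → α < αbar →
      ∃ l K : ℝ, 0 < l ∧ l < 1 ∧ 0 < K ∧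
        ∀ (n : ℕ) (β₂ η ζ : ℝ) (f : Fin N → ℕ → Dec n → ℝ) (xstar : ℕ → Dec n)
          (x₀ : Fin N → Dec n),
          β₂ ∈ Set.Ioo (0 : ℝ) 1 → 0 < η → 0 < ζ → OnlineProblem L q η ζ f xstar → ∀ t,
            gap f xstar t (avg (gtadam W ⟨α, β₁, β₂, ε, G⟩ f x₀ t).x) ≤
              K * (l ^ t * ‖errorVec (gtadam W ⟨α, β₁, β₂, ε, G⟩ f x₀ 0) (xstar 0)‖ ^ 2
                + Qconst N L η ζ) := by
  have hD := hW.doubly_stochastic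
  obtain ⟨γ, Cp, hγ0, hγ1, hCp, hP⟩ := exists_contractive_norm
    (B := Matrix.of fun i j => W i j - 1 / (N : ℝ)) hW.spectral_gap
  have hCp0 : 0 < Cp := by linarith
  set a : ℝ := 1 / √(G + ε) with ha
  set b : ℝ := 1 / √ε with hb
  have ha0 : 0 < a := by positivity
  have hb0 : 0 < b := by positivity
  set κ : ℝ := √(N * (b ^ 2 / a + a / 4))
  have hκ : 0 ≤ κ := Real.sqrt_nonneg _
  set D : ℝ := L * √(2 / q)
  have hD0 : 0 ≤ D := by positivity
  set A : ℝ := N * √(2 / q) + √(N * L / 2)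
  have hA0 : 0 ≤ A := by positivity
  -- A single constant dominating every coefficient of the four recursions.
  set C : ℝ := b * (D + 1 + L) + κ * (1 + L) + A + (1 + L) + 4 * Cp * (1 + L) with hC
  have i1 : 0 ≤ b * (D + 1 + L) := by positivity
  have i2 : 0 ≤ κ * (1 + L) := by positivity
  have i3 : 0 < Cp * L := by positivity
  have hC0 : 0 < C := by positivity
  obtain ⟨α₀, θ, w, K, hα₀, hθ, hw, hK, hrec⟩ := exists_coupled_contraction
    (lt_max_of_lt_left hγ0 : 0 < max γ β₁) (max_lt hγ1 hβ₁.2) (by positivity : 0 < a * q / 2) hC0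
  -- Beyond the small-gain threshold `α₀`, the second bound absorbs the second-order descent term
  -- and the third keeps the contraction factor of the gap nonnegative.
  refine ⟨min α₀ (min (a / 4 / (L * b ^ 2)) (1 / (a * q))), by positivity, fun α hα hαb => ?_⟩
  obtain ⟨hαb0, hαb'⟩ := lt_min_iff.1 hαb
  obtain ⟨hαb1, hαb2⟩ := lt_min_iff.1 hαb'
  have hαL : α * (L * b ^ 2) ≤ a / 4 := ((lt_div_iff₀ (by positivity)).1 hαb1).le
  have hαq : α * (a * q) ≤ 1 := ((lt_div_iff₀ (by positivity)).1 hαb2).le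
  obtain ⟨l, hl0, hl1, hstep⟩ := hrec α hα hαb0
  have hl : 0 < 1 - l := by linarith
  set K₀ : ℝ := √(N * L / 2) + θ * (L + w * Cp + w ^ 2 * Cp) with hK₀
  have hw0 : 0 < w := by linarith
  have hK₀0 : 0 < K₀ := by positivity
  -- From `(u + v) ^ 2 ≤ 2 * u ^ 2 + 2 * v ^ 2` and `(η + ζ) ^ 2 ≤ 2 * Q`, given `V 0 ≤ K₀ * ‖y₀‖`.
  refine ⟨l, 2 * K₀ ^ 2 + 4 * (K / (1 - l)) ^ 2, hl0, hl1, by positivity, ?_⟩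
  intro n β₂ η ζ f xstar x₀ hβ₂ hη hζ hf
  obtain ⟨P, hPadd, hPge, hPle, hPc⟩ := hP n
  set p : Tuning := ⟨α, β₁, β₂, ε, G⟩ with hp
  set z := gtadam W p f x₀ with hz
  set ψ : ℕ → ℝ := fun t => √(gap f xstar t (avg (z t).x)) with hψ
  set m : ℕ → ℝ := fun t => ‖(z t).m - fun _ => meanGradient f t (avg (z t).x)‖ with hm
  set s : ℕ → ℝ := fun t => P (deviation (z t).s) with hs
  set x : ℕ → ℝ := fun t => P (deviation (z t).x) with hx
  have hψ0 : ∀ t, 0 ≤ ψ t := fun t => Real.sqrt_nonneg _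
  have hm0 : ∀ t, 0 ≤ m t := fun t => norm_nonneg _
  have hs0 : ∀ t, 0 ≤ s t := fun t => (norm_nonneg _).trans (hPge _)
  have hx0 : ∀ t, 0 ≤ x t := fun t => (norm_nonneg _).trans (hPge _)
  set V : ℕ → ℝ := fun t => ψ t + θ * (m t + w * s t + w ^ 2 * x t) with hV
  have hVrec : ∀ t, V (t + 1) ≤ l * V t + K * (η + ζ) := by
    intro t
    have hv : ∀ i k, 0 ≤ (z t).v i k := gtadam_v_nonneg (p := p) hβ₂ hG x₀ t
    have havg := avg_gtadam_s (f := f) (p := p) hD x₀ t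
    set μ := meanGradient f t (avg (z t).x)
    set r := ‖nextM p (z t) - fun _ => μ‖
    set Δ := ‖nextD p (z t)‖
    have hr0 : 0 ≤ r := norm_nonneg _
    have hΔ0 : 0 ≤ α * Δ := mul_nonneg hα.le (norm_nonneg _)
    have gs : ‖deviation (z t).s‖ ≤ s t := hPge _
    have gx : ‖deviation (z t).x‖ ≤ x t := hPge _
    have hr : r ≤ β₁ * m t + (s t + L * x t) :=
      (norm_nextM_sub_meanGradient_le (p := p) hf hN hL hβ₁ havg).trans
        (add_le_add_right (add_le_add gs (mul_le_mul_of_nonneg_left gx hL.le)) _)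
    have hr' : r ≤ (1 + L) * (m t + s t + x t) := by
      have e1 := mul_le_mul_of_nonneg_right hβ₁.2.le (hm0 t)
      have e2 : 0 ≤ L * m t + L * s t + x t := by
        have := hm0 t; have := hs0 t; have := hx0 t; positivity
      linarith
    have hμ : ‖μ‖ ≤ D * ψ t := by
      have := (hf.norm_meanGradient_le hN hL t (avg (z t).x)).trans
        (mul_le_mul_of_nonneg_left (hf.dist_minimizer_le hN hq t _) hL.le)
      rwa [← mul_assoc] at this
    have hΔ₀ : Δ ≤ b * (‖μ‖ + r) := norm_nextD_le (p := p) hβ₂ hG hε hv μ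
    have hΔ : Δ ≤ C * (ψ t + m t + s t + x t) := by
      have hS : 0 ≤ ψ t + m t + s t + x t := by linarith [hψ0 t, hm0 t, hs0 t, hx0 t]
      have e1 : ‖μ‖ + r ≤ (D + 1 + L) * (ψ t + m t + s t + x t) := by
        have : 0 ≤ D * (m t + s t + x t) + (1 + L) * ψ t := by
          have := hm0 t; have := hs0 t; have := hx0 t; have := hψ0 t; positivity
        linarith
      have e2 := mul_le_mul_of_nonneg_left e1 hb0.le
      have e3 : b * (D + 1 + L) ≤ C := by linarith
      linarith [mul_le_mul_of_nonneg_right e3 hS]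
    have hC1 : 1 + L ≤ C := by linarith
    have hC2 : 4 * Cp * (1 + L) ≤ C := by linarith
    have hηC : η ≤ C * (η + ζ) := by
      have e1 := mul_le_mul_of_nonneg_right hC1 (by positivity : 0 ≤ η + ζ)
      have e2 : 0 ≤ L * (η + ζ) := by positivity
      linarith
    refine hstep (ψ t) (m t) (s t) (x t) Δ (η + ζ) _ _ _ _ (hψ0 t) (hm0 t) (hs0 t) (hx0 t)
      (by positivity) hΔ ?_ ?_ ?_ ?_
    · have e1 := hf.sqrt_gap_succ_le hN hL hq hη.le hζ.le t (avg (z (t + 1)).x)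
      have e2 := hf.sqrt_gap_step_le hN hL hq ha0 hα hr0 hαL hαq t
        (inner_avg_nextD_ge (p := p) hN hβ₂ hG hε hv μ)
        ((norm_avg_le hN (nextD p (z t))).trans hΔ₀)
      have e3 : avg (z (t + 1)).x = avg (z t).x - α • avg (nextD p (z t)) :=
        avg_nextX (p := p) hD
      rw [← e3] at e2
      have hS : 0 ≤ m t + s t + x t := by linarith [hm0 t, hs0 t, hx0 t]
      have e4 : κ * r ≤ C * (m t + s t + x t) := by
        have f1 := mul_le_mul_of_nonneg_left hr' hκ
        have f2 : κ * (1 + L) ≤ C := by linarith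
        linarith [mul_le_mul_of_nonneg_right f2 hS]
      have e5 := mul_le_mul_of_nonneg_left e4 (Real.sqrt_nonneg α)
      have e6 := mul_le_mul_of_nonneg_right (by linarith : A ≤ C) (by positivity : 0 ≤ η + ζ)
      exact e1.trans (by linarith)
    · have e1 := norm_nextM_sub_meanGradient_succ_le (p := p) (z := z t) (t := t) hf hN hL hη.le
        hα.le hD
      have e2 := mul_le_mul_of_nonneg_right (le_max_right γ β₁) (hm0 t)
      have e3 := mul_le_mul_of_nonneg_right (by linarith : L ≤ C) hΔ0
      have e4 : s t + L * x t ≤ C * (s t + x t) := by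
        have f1 := mul_le_mul_of_nonneg_right (by linarith : 1 ≤ C) (hs0 t)
        have f2 := mul_le_mul_of_nonneg_right (by linarith : L ≤ C) (hx0 t)
        linarith
      exact e1.trans (by linarith)
    · have e1 := contractive_deviation_stackMul_add_le hN hD hCp0.le hPadd hPle hPc (z t).s
        (fun i => gradient (f i (t + 1)) (nextX W p (z t) i) - gradient (f i t) ((z t).x i))
      have e2 := norm_gradient_increment_le hf hL hη.le (z t).x (nextX W p (z t)) t
      have e3 := norm_nextX_sub_le (p := p) (z := z t) hα.le hD
      have e4 : ‖fun i => gradient (f i (t + 1)) (nextX W p (z t) i) -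
          gradient (f i t) ((z t).x i)‖ ≤ L * (2 * x t + α * Δ) + η :=
        e2.trans (add_le_add_left (mul_le_mul_of_nonneg_left (e3.trans (by linarith)) hL.le) _)
      have e5 := mul_le_mul_of_nonneg_left e4 (by positivity : 0 ≤ 2 * Cp)
      have e6 := mul_le_mul_of_nonneg_right (le_max_left γ β₁) (hs0 t)
      have e7 := mul_le_mul_of_nonneg_right (by linarith : 4 * Cp * L ≤ C) (hx0 t)
      have e8 := mul_le_mul_of_nonneg_right (by linarith : 2 * Cp * L ≤ C) hΔ0
      have e9 := mul_le_mul_of_nonneg_right (by linarith : 2 * Cp ≤ C) (by positivity : 0 ≤ η + ζ)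
      have e10 : 0 ≤ 2 * Cp * ζ := by positivity
      exact e1.trans (by linarith)
    · have e1 := contractive_deviation_stackMul_add_le hN hD hCp0.le hPadd hPle hPc (z t).x
        (-(α • nextD p (z t)))
      rw [← sub_eq_add_neg, norm_neg, norm_smul, Real.norm_of_nonneg hα.le] at e1
      have e2 := mul_le_mul_of_nonneg_right (le_max_left γ β₁) (hx0 t)
      have e3 := mul_le_mul_of_nonneg_right (by linarith : 2 * Cp ≤ C) hΔ0
      exact e1.trans (by linarith)
  set Y := ‖errorVec (z 0) (xstar 0)‖
  have hY0 : 0 ≤ Y := norm_nonneg _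
  have hV0 : V 0 ≤ K₀ * Y := by
    have c3 : disagreement (z 0).s ≤ Y :=
      (le_abs_self _).trans (PiLp.norm_apply_le (errorVec (z 0) (xstar 0)) 3)
    have c4 : disagreement (z 0).x ≤ Y :=
      (le_abs_self _).trans (PiLp.norm_apply_le (errorVec (z 0) (xstar 0)) 4)
    have c5 : ‖avg (z 0).x - xstar 0‖ ≤ Y :=
      (le_abs_self _).trans (PiLp.norm_apply_le (errorVec (z 0) (xstar 0)) 5)
    have v1 : ψ 0 ≤ √(N * L / 2) * Y := by
      refine (Real.sqrt_le_sqrt (hf.gap_le_sq_dist hN hL 0 _)).trans ?_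
      rw [Real.sqrt_mul (by positivity), Real.sqrt_sq (norm_nonneg _)]
      exact mul_le_mul_of_nonneg_left c5 (Real.sqrt_nonneg _)
    have v2 : m 0 ≤ L * Y := by
      have e : (z 0).m = 0 := rfl
      simp only [hm, e, zero_sub, norm_neg]
      exact (norm_const_le _).trans ((hf.norm_meanGradient_le hN hL 0 _).trans
        (mul_le_mul_of_nonneg_left c5 hL.le))
    have v3 : s 0 ≤ Cp * Y := (hPle _).trans
      (mul_le_mul_of_nonneg_left ((norm_deviation_le_disagreement _).trans c3) hCp0.le)
    have v4 : x 0 ≤ Cp * Y := (hPle _).trans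
      (mul_le_mul_of_nonneg_left ((norm_deviation_le_disagreement _).trans c4) hCp0.le)
    have v5 : m 0 + w * s 0 + w ^ 2 * x 0 ≤ (L + w * Cp + w ^ 2 * Cp) * Y := by
      linarith [mul_le_mul_of_nonneg_left v3 hw0.le, mul_le_mul_of_nonneg_left v4 (sq_nonneg w)]
    have v6 := mul_le_mul_of_nonneg_left v5 hθ.le
    simp only [hV, hK₀]
    linarith
  intro t
  have h1 := le_geometric_of_recursion hl0.le hl1 (by positivity) hVrec t
  have h2 : ψ t ≤ V t := by
    have := hm0 t; have := hs0 t; have := hx0 t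
    exact le_add_of_nonneg_right (by positivity)
  have h3 := mul_le_mul_of_nonneg_left hV0 (pow_nonneg hl0.le t)
  have h4 : ψ t ≤ l ^ t * (K₀ * Y) + K / (1 - l) * (η + ζ) := by
    rw [div_mul_eq_mul_div]
    linarith
  have h5 : gap f xstar t (avg (z t).x) = ψ t ^ 2 := (Real.sq_sqrt (hf.gap_nonneg t _)).symm
  have h6 := (pow_le_pow_left₀ (hψ0 t) h4 2).trans (add_sq_le (a := l ^ t * (K₀ * Y)))
  have h7 : (l ^ t) ^ 2 ≤ l ^ t := by
    rw [sq]
    exact mul_le_of_le_one_left (pow_nonneg hl0.le t) (pow_le_one₀ hl0.le hl1.le)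
  have h8 := mul_le_mul_of_nonneg_left h7 (by positivity : 0 ≤ 2 * (K₀ ^ 2 * Y ^ 2))
  have h9 := mul_le_mul_of_nonneg_left (sq_add_le_two_mul_Qconst hN L η ζ)
    (by positivity : 0 ≤ 2 * (K / (1 - l)) ^ 2)
  have h10 : 0 ≤ 2 * K₀ ^ 2 * Qconst N L η ζ :=
    mul_nonneg (by positivity) (Qconst_nonneg N L η ζ)
  have h11 : 0 ≤ 4 * (K / (1 - l)) ^ 2 * (l ^ t * Y ^ 2) := by positivity
  rw [h5]
  refine h6.trans ?_
  linarith

/-! ### Average regret and the choice of the rate -/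

theorem regret_eq_sum_gap {N n : ℕ} (f : Fin N → ℕ → Dec n → ℝ) (z : ℕ → AgentState N n)
    (xstar : ℕ → Dec n) (T : ℕ) :
    regret f z xstar T = ∑ t ∈ Finset.Icc 1 T, gap f xstar t (avg (z t).x) := by
  simp only [regret, gap, Finset.sum_sub_distrib]

/-- The geometric part has a bounded sum, which vanishes after division by `T`. -/
theorem limsup_average_le {u : ℕ → ℝ} {l A B : ℝ} (hl0 : 0 ≤ l) (hl1 : l < 1) (hA : 0 ≤ A)
    (hu : ∀ t, u t ≤ A * l ^ t + B) :
    limsup (fun T : ℕ => (((∑ t ∈ Finset.Icc 1 T, u t) / (T : ℝ) : ℝ) : EReal)) atTop ≤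
      (B : EReal) := by
  have hbound : ∀ T : ℕ, 0 < T →
      (∑ t ∈ Finset.Icc 1 T, u t) / (T : ℝ) ≤ A * (1 - l)⁻¹ / (T : ℝ) + B := by
    intro T hT
    have hT' : (0 : ℝ) < T := by positivity
    have h1 := Finset.sum_le_sum fun t (_ : t ∈ Finset.Icc 1 T) => hu t
    rw [Finset.sum_add_distrib, ← Finset.mul_sum, Finset.sum_const, Nat.card_Icc,
      Nat.add_sub_cancel, nsmul_eq_mul] at h1
    have h2 := (summable_geometric_of_lt_one hl0 hl1).sum_le_tsum (Finset.Icc 1 T)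
      fun t _ => pow_nonneg hl0 t
    rw [tsum_geometric_of_lt_one hl0 hl1] at h2
    have h3 := mul_le_mul_of_nonneg_left h2 hA
    rw [div_add' _ _ _ hT'.ne']
    exact div_le_div_of_nonneg_right (by linarith) hT'.le
  have ht : Tendsto (fun T : ℕ => A * (1 - l)⁻¹ / (T : ℝ) + B) atTop (nhds B) := by
    simpa using (tendsto_const_div_atTop_nhds_zero_nat (A * (1 - l)⁻¹)).add_const B
  have ht' : Tendsto (fun T : ℕ => ((A * (1 - l)⁻¹ / (T : ℝ) + B : ℝ) : EReal)) atTop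
      (nhds (B : EReal)) := (continuous_coe_real_ereal.tendsto B).comp ht
  rw [← ht'.limsup_eq]
  refine limsup_le_limsup ?_
  filter_upwards [eventually_gt_atTop 0] with T hT
  exact EReal.coe_le_coe_iff.2 (hbound T hT)

theorem exists_rate_lt_one {l K c : ℝ} (hl1 : l < 1) (hc : 0 < c) :
    ∃ ρ : ℝ, 0 < ρ ∧ ρ < 1 ∧ l < ρ ^ 2 ∧ K * (1 - ρ) ^ 2 ≤ c := by
  have h1 : ∀ᶠ ρ : ℝ in nhds 1, l < ρ ^ 2 :=
    (by fun_prop : Continuous fun ρ : ℝ => ρ ^ 2).continuousAt.eventually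
      (lt_mem_nhds (by simpa using hl1))
  have h2 : ∀ᶠ ρ : ℝ in nhds 1, K * (1 - ρ) ^ 2 < c :=
    (by fun_prop : Continuous fun ρ : ℝ => K * (1 - ρ) ^ 2).continuousAt.eventually
      (gt_mem_nhds (by simpa using hc))
  have h3 : ∀ᶠ ρ : ℝ in nhds 1, 0 < ρ := lt_mem_nhds one_pos
  obtain ⟨ρ, ⟨⟨e1, e2⟩, e3⟩, e4⟩ := ((((h1.and h2).and h3).filter_mono
    nhdsWithin_le_nhds).and
      (self_mem_nhdsWithin : Set.Iio (1 : ℝ) ∈ nhdsWithin 1 (Set.Iio 1))).exists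
  exact ⟨ρ, e3, e4, e1, e2.le⟩

theorem mainTheorem2
    (N : ℕ) (hN : 0 < N)
    (W : Matrix (Fin N) (Fin N) ℝ) (hW : NetworkStructure W)
    (L q β₁ ε G : ℝ) (hL : 0 < L) (hq : 0 < q) (hβ₁ : β₁ ∈ Set.Ioo (0 : ℝ) 1)
    (hε : 0 < ε) (hG : 0 < G) :
    ∃ αbar : ℝ, 0 < αbar ∧ ∀ α : ℝ, 0 < α → α < αbar →
      ∃ ρ : ℝ, 0 < ρ ∧ ρ < 1 ∧ ∃ t₀ : ℕ,
        ∀ (n : ℕ) (β₂ η ζ : ℝ) (f : Fin N → ℕ → Dec n → ℝ) (xstar : ℕ → Dec n)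
          (x₀ : Fin N → Dec n) (z : ℕ → AgentState N n),
          β₂ ∈ Set.Ioo (0 : ℝ) 1 → 0 < η → 0 < ζ → OnlineProblem L q η ζ f xstar →
          z = gtadam W ⟨α, β₁, β₂, ε, G⟩ f x₀ →
          limsup (fun T : ℕ => ((regret f z xstar T / (T : ℝ) : ℝ) : EReal)) atTop
              ≤ ((L / 2 * (Qconst N L η ζ / (1 - ρ) ^ 2) : ℝ) : EReal) ∧
          ∀ t : ℕ, t₀ ≤ t →
            totalCost f t (avg (z t).x) - totalCost f t (xstar t) ≤
              L / 2 * (ρ ^ (2 * t) * ‖errorVec (z 0) (xstar 0)‖ ^ 2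
                + 2 * ρ ^ t *
                  (‖errorVec (z 0) (xstar 0)‖ * Real.sqrt (Qconst N L η ζ) / (1 - ρ))
                + Qconst N L η ζ / (1 - ρ) ^ 2) := by
  obtain ⟨αbar, hαbar, h⟩ := exists_gap_gtadam_le hN hW hL hq hβ₁ hε hG
  refine ⟨αbar, hαbar, fun α hα hαb => ?_⟩
  obtain ⟨l, K, hl0, hl1, hK, hgap⟩ := h α hα hαb
  -- This `ρ` is not the contraction factor: it is pushed towards `1` until `K ≤ L / 2 / (1 - ρ) ^
  -- 2`.
  obtain ⟨ρ, hρ0, hρ1, hlρ, hKρ⟩ := exists_rate_lt_one (K := K) hl1 (half_pos hL)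
  have hρ : 0 < 1 - ρ := by linarith
  have hlim : Tendsto (fun t : ℕ => K * (l / ρ ^ 2) ^ t) atTop (nhds 0) := by
    simpa using (tendsto_pow_atTop_nhds_zero_of_lt_one (by positivity)
      ((div_lt_one (by positivity)).2 hlρ)).const_mul K
  -- Since `l < ρ ^ 2`, the constant `K` in front of `l ^ t` is eventually beaten by `ρ ^ (2 * t)`;
  -- this is the role of `t₀`.
  obtain ⟨t₀, ht₀⟩ := eventually_atTop.1 (hlim.eventually (gt_mem_nhds (half_pos hL)))
  refine ⟨ρ, hρ0, hρ1, t₀, ?_⟩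
  rintro n β₂ η ζ f xstar x₀ z hβ₂ hη hζ hf rfl
  have hg := hgap n β₂ η ζ f xstar x₀ hβ₂ hη hζ hf
  have hQ := Qconst_nonneg N L η ζ
  set Q := Qconst N L η ζ
  set z := gtadam W ⟨α, β₁, β₂, ε, G⟩ f x₀
  set Y := ‖errorVec (z 0) (xstar 0)‖
  have hY : 0 ≤ Y := norm_nonneg _
  have hKQ : K * Q ≤ L / 2 * (Q / (1 - ρ) ^ 2) := by
    rw [mul_div_assoc', le_div_iff₀ (by positivity)]
    linarith [mul_le_mul_of_nonneg_right hKρ hQ]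
  constructor
  · simp only [regret_eq_sum_gap]
    refine (limsup_average_le hl0.le hl1 (by positivity : 0 ≤ K * Y ^ 2) (B := K * Q)
      fun t => ?_).trans (EReal.coe_le_coe_iff.2 hKQ)
    linarith [hg t]
  · intro t ht
    have h1 : K * l ^ t ≤ L / 2 * ρ ^ (2 * t) := by
      have := (ht₀ t ht).le
      rwa [div_pow, ← pow_mul, mul_div_assoc', div_le_iff₀ (by positivity)] at this
    have h2 := mul_le_mul_of_nonneg_right h1 (sq_nonneg Y)
    -- The cross term of the claimed bound is pure slack.
    have h3 : 0 ≤ L / 2 * (2 * ρ ^ t * (Y * Real.sqrt Q / (1 - ρ))) := by positivity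
    have h4 := hg t
    rw [gap] at h4
    linarith
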